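/- Let $k$ be a field of characteristic $0$, let $N$ be a finitely generated free abelian group, $M=\operatorname{Hom}(N,\mathbb Z)$, let $\sigma\subset N_{\mathbb R}$ be a rational polyhedral cone with apex $0$, and $\Lambda=\sigma^\vee\cap M$. For $R\in M$ put $\Lambda(R)=\Lambda+R$. *Cochains.* For $P\subset\Lambda$ let $S_n(P)=\{(\lambda_1,\dots,\lambda_n)\in P^n\mid \sum_v\lambda_v\in P\}$. For $Q\subset P$ and $1\le i\le n$ let $C^n_{(i)}(P,Q;k)$ be the space of functions $\varphi:S_n(P)\to k$ which vanish on $S_n(Q)$ and satisfy $\varphi\circ s_n=(2^i-2)\varphi$, where $s_n$ is the sum over $r=1,\dots,n-1$ of the signed sums of all $(r,n-r)$-shuffles. In all the cases below these spaces form a complex under $$(d\varphi)(\lambda_1,\dots,\lambda_{n+1})=\varphi(\lambda_2,\dots,\lambda_{n+1})+\sum_{j=1}^{n}(-1)^j\varphi(\lambda_1,\dots,\lambda_j+\lambda_{j+1},\dots,\lambda_{n+1})+(-1)^{n+1}\varphi(\lambda_1,\dots,\lambda_n),$$ with cohomology $H^n_{(i)}(P,Q;k)$. Write $C^n_{(i)}(P;k)=C^n_{(i)}(P,\emptyset;k)$,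 $H^n_{(i)}(P;k)=H^n_{(i)}(P,\emptyset;k)$ and $H^n_{(i)}(-R)=H^n_{(i)}(\Lambda,\Lambda\setminus\Lambda(R);k)$ (the part of degree $-R$ of the Hochschild cohomology of $k[\Lambda]$). *Double complex.* For a face $\tau\le\sigma$ let $K_\tau^R=\Lambda\cap(R-\operatorname{int}\tau^\vee)$, so $K_0^R=\Lambda$, and let $C^q_{(i)}(K^R_p;k)=\bigoplus_{\dim\tau=p}C^q_{(i)}(K^R_\tau;k)$ for $q\ge i$. After fixing orientations of the faces, let $\delta:C^q_{(i)}(K^R_p;k)\to C^q_{(i)}(K^R_{p+1};k)$ be the sum of the restriction maps for $\tau\le\tau'$, with signs comparing the orientations of $\tau$ and $\tau'$. The total complex $\operatorname{tot}^\bullet(C^\bullet_{(i)}(K^R_\bullet;k))$ has the differential $\delta+(-1)^pd$. The inclusion $C^n_{(i)}(\Lambda,\Lambda\setminus\Lambda(R);k)\subset C^n_{(i)}(\Lambda;k)=C^n_{(i)}(K_0^R;k)$ induces a canonical map $H^n_{(i)}(-R)\to H^n(\operatorname{tot}^\bullet(C^\bullet_{(i)}(K^R_\bullet;k)))$. *Product.*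 For 2-cochains $f\in C^2_{(i)}(\Lambda,\Lambda\setminus\Lambda(R);k)$ and $g\in C^2_{(j)}(\Lambda,\Lambda\setminus\Lambda(S);k)$, with $\{i,j\}=\{1,2\}$, the Gerstenhaber product is given by $$[f,g](\lambda_1,\lambda_2,\lambda_3)=f(-S+\lambda_1+\lambda_2,\lambda_3)g(\lambda_1,\lambda_2)-f(\lambda_1,-S+\lambda_2+\lambda_3)g(\lambda_2,\lambda_3)+g(-R+\lambda_1+\lambda_2,\lambda_3)f(\lambda_1,\lambda_2)-g(\lambda_1,-R+\lambda_2+\lambda_3)f(\lambda_2,\lambda_3);$$ here and below, the value of a cochain on $\Lambda$ is read as $0$ if one of its arguments is not in $\Lambda$. **Statement.** Let $R,S\in M$, let $\mu\in H^1_{(1)}(\Lambda\setminus\Lambda(S);k)$ (an additive function on $\Lambda\setminus\Lambda(S)$), let $\mu^0$ be its extension to $\Lambda$ by zero, and let $\xi\in C^2_{(2)}(\Lambda,\Lambda\setminus\Lambda(R);k)$ be a cocycle, that is, an element of $H^2_{(2)}(-R)$ (note $C^1_{(2)}=0$). Put $$B(\lambda_1,\lambda_2)=\xi(-S+\lambda_1+\lambda_2,\lambda_2)\mu^0(\lambda_1)+\xi(\lambda_1,-S+\lambda_1+\lambda_2)\mu^0(\lambda_2)-\xi(\lambda_1,\lambda_2)\mu^0(\lambda_1+\lambda_2-R).$$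 Then $d\mu^0$ is a cocycle in $C^2_{(1)}(\Lambda,\Lambda\setminus\Lambda(S);k)$, $B\in C^2_{(2)}(\Lambda;k)$, $[d\mu^0,\xi]$ is a cocycle in $C^3_{(2)}(\Lambda,\Lambda\setminus\Lambda(R+S);k)$, and $$(\delta B,\;dB-[d\mu^0,\xi])\in C^2_{(2)}(K_1^{R+S};k)\oplus C^3_{(2)}(\Lambda;k)$$ is a cocycle of degree $3$ of $\operatorname{tot}^\bullet(C^\bullet_{(2)}(K^{R+S}_\bullet;k))$. The canonical map $H^3_{(2)}(-R-S)\to H^3(\operatorname{tot}^\bullet(C^\bullet_{(2)}(K^{R+S}_\bullet;k)))$ is injective, and it sends the Gerstenhaber product $[d\mu^0,\xi]\in H^3_{(2)}(-R-S)$ to minus the class of $(\delta B,\,dB-[d\mu^0,\xi])$; that is, to the class of $(-\delta B,\,[d\mu^0,\xi]-dB)$. -/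

import Mathlib

open scoped TensorProduct

namespace ToricHochschild

noncomputable section

/-! ### Cochains on subsets of an abelian group, and the Hodge pieces -/

section Cochains

variable {M : Type*} [AddCommGroup M] (k : Type*) [Field k]

/-- `S_n(P)`: the `n`-tuples of elements of `P` whose sum is again in `P`. -/
def tuples (P : Set M) (n : ℕ) : Set (Fin n → M) :=
  {v | (∀ j, v j ∈ P) ∧ ∑ j, v j ∈ P}

/-- All functions `S_n(P) → k`. -/
abbrev Cochain (P : Set M) (n : ℕ) : Type _ := tuples P n → k

variable {k}

open Classical in
/-- Evaluation of a cochain, with the convention that its value outside `S_n(P)` is `0`. -/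
def ev {P : Set M} {n : ℕ} (φ : Cochain k P n) (v : Fin n → M) : k :=
  if h : v ∈ tuples P n then φ ⟨v, h⟩ else 0

lemma ev_of_mem {P : Set M} {n : ℕ} (φ : Cochain k P n) {v : Fin n → M} (h : v ∈ tuples P n) :
    ev φ v = φ ⟨v, h⟩ := dif_pos h

lemma ev_add {P : Set M} {n : ℕ} (φ ψ : Cochain k P n) (v : Fin n → M) :
    ev (φ + ψ) v = ev φ v + ev ψ v := by
  unfold ev; split_ifs <;> simp

lemma ev_smul {P : Set M} {n : ℕ} (c : k) (φ : Cochain k P n) (v : Fin n → M) :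
    ev (c • φ) v = c * ev φ v := by
  unfold ev; split_ifs <;> simp

/-- Restriction of cochains from `P` to `P'` (it is used for `P' ⊆ P`). -/
def res {P : Set M} (P' : Set M) {n : ℕ} : Cochain k P n →ₗ[k] Cochain k P' n where
  toFun φ := fun v => ev φ v
  map_add' φ ψ := by funext v; exact ev_add φ ψ v
  map_smul' c φ := by funext v; exact ev_smul c φ v

/-- The differential
`(dφ)(λ₁,…,λₙ₊₁) = φ(λ₂,…,λₙ₊₁) + ∑ⱼ (-1)^j φ(λ₁,…,λⱼ+λⱼ₊₁,…,λₙ₊₁) + (-1)^(n+1) φ(λ₁,…,λₙ)`.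
The summand of the last index of `Fin (n + 1)` is the last term: there `Fin.contractNth` drops the
last entry. For the sets used below all the tuples at which `φ` is evaluated lie in `S_n(P)`. -/
def diff {P : Set M} (n : ℕ) : Cochain k P n →ₗ[k] Cochain k P (n + 1) where
  toFun φ := fun v => ev φ (fun j : Fin n => v.1 j.succ) +
    ∑ j : Fin (n + 1), (-1 : k) ^ ((j : ℕ) + 1) * ev φ (Fin.contractNth j (· + ·) v.1)
  map_add' φ ψ := by
    funext v
    simp only [ev_add, mul_add, Finset.sum_add_distrib, Pi.add_apply]
    ring
  map_smul' c φ := by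
    funext v
    simp only [ev_smul, RingHom.id_apply, Pi.smul_apply, smul_eq_mul, mul_add, Finset.mul_sum]
    congr 1
    refine Finset.sum_congr rfl fun j _ => ?_
    ring

/-- `π` is an `(r, n - r)`-shuffle: increasing on the first `r` and on the last `n - r` indices. -/
def IsShuffle {n : ℕ} (r : ℕ) (π : Equiv.Perm (Fin n)) : Prop :=
  ∀ a b : Fin n, a < b → ((b : ℕ) < r ∨ r ≤ (a : ℕ)) → π a < π b

open Classical in
/-- The function `φ ∘ s_n`, where `s_n = ∑_{r=1}^{n-1} s_{r,n-r}` and `s_{r,n-r}` is the signed sum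
of the shuffles; a permutation acts on tuples by `π (λ₁,…,λₙ) = (λ_{π⁻¹(1)},…,λ_{π⁻¹(n)})`. -/
def shuffle {P : Set M} {n : ℕ} (φ : Cochain k P n) (v : Fin n → M) : k :=
  ∑ r ∈ Finset.Ico 1 n, ∑ π : Equiv.Perm (Fin n),
    if IsShuffle r π then (((Equiv.Perm.sign π : ℤ) : k)) * ev φ (fun j => v (π⁻¹ j)) else 0

lemma shuffle_add {P : Set M} {n : ℕ} (φ ψ : Cochain k P n) (v : Fin n → M) :
    shuffle (φ + ψ) v = shuffle φ v + shuffle ψ v := by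
  simp only [shuffle, ← Finset.sum_add_distrib]
  refine Finset.sum_congr rfl fun r _ => Finset.sum_congr rfl fun π _ => ?_
  split_ifs
  · rw [ev_add, mul_add]
  · simp

lemma shuffle_smul {P : Set M} {n : ℕ} (c : k) (φ : Cochain k P n) (v : Fin n → M) :
    shuffle (c • φ) v = c * shuffle φ v := by
  simp only [shuffle, Finset.mul_sum]
  refine Finset.sum_congr rfl fun r _ => Finset.sum_congr rfl fun π _ => ?_
  split_ifs
  · rw [ev_smul]; ring
  · simp

variable (k) in
/-- `C^n_{(i)}(P, Q; k)` for `i ≤ n` (and `0` for `n < i`): the cochains `φ` on `S_n(P)` with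
`φ ∘ s_n = (2^i - 2) φ` which vanish on `S_n(Q)`. -/
def hodge (i n : ℕ) (P Q : Set M) : Submodule k (Cochain k P n) where
  carrier := {φ | (n < i → φ = 0) ∧
    (∀ v : tuples P n, shuffle φ v = ((2 : k) ^ i - 2) * φ v) ∧
    ∀ v : tuples P n, (v : Fin n → M) ∈ tuples Q n → φ v = 0}
  zero_mem' := by
    refine ⟨fun _ => rfl, fun v => ?_, fun _ _ => rfl⟩
    have := shuffle_smul (0 : k) (0 : Cochain k P n) v
    simpa using this
  add_mem' := by
    rintro φ ψ ⟨h0, h1, h2⟩ ⟨h0', h1', h2'⟩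
    refine ⟨fun h => by rw [h0 h, h0' h, add_zero], fun v => ?_, fun v hv => ?_⟩
    · rw [shuffle_add, h1, h1', Pi.add_apply, mul_add]
    · rw [Pi.add_apply, h2 v hv, h2' v hv, add_zero]
  smul_mem' := by
    rintro c φ ⟨h0, h1, h2⟩
    refine ⟨fun h => by rw [h0 h, smul_zero], fun v => ?_, fun v hv => ?_⟩
    · rw [shuffle_smul, h1, Pi.smul_apply, smul_eq_mul]; ring
    · rw [Pi.smul_apply, h2 v hv, smul_zero]

variable (k) in
/-- The cocycles in `C^n_{(i)}(P, Q; k)`. -/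
def cocycles (i n : ℕ) (P Q : Set M) : Submodule k (Cochain k P n) :=
  hodge k i n P Q ⊓ LinearMap.ker (diff n)

variable (k) in
/-- The coboundaries `d (C^n_{(i)}(P, Q; k))`, in degree `n + 1`. -/
def coboundaries (i n : ℕ) (P Q : Set M) : Submodule k (Cochain k P (n + 1)) :=
  (hodge k i n P Q).map (diff n)

variable (k) in
/-- `H^{n+1}_{(i)}(P, Q; k)`: cocycles of degree `n + 1` modulo coboundaries. -/
abbrev Cohomology (i n : ℕ) (P Q : Set M) : Type _ :=
  cocycles k i (n + 1) P Q ⧸ (coboundaries k i n P Q).submoduleOf (cocycles k i (n + 1) P Q)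

end Cochains

/-! ### Cones, lattice points, and the sets `K_τ^R` -/

section Cones

/-- The real vector space `N_ℝ`. -/
abbrev RealSpace (N : Type*) [AddCommGroup N] : Type _ := ℝ ⊗[ℤ] N

/-- A rational polyhedral cone in `N_ℝ` with apex `0`. -/
structure RationalCone (N : Type*) [AddCommGroup N] where
  /-- the underlying convex cone -/
  cone : PointedCone ℝ (RealSpace N)
  rational : ∃ s : Finset N, cone = PointedCone.hull ℝ ((fun a : N => (1 : ℝ) ⊗ₜ[ℤ] a) '' s)
  salient : (cone : ConvexCone ℝ (RealSpace N)).Salient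

variable {N : Type*} [AddCommGroup N]

/-- The pairing `⟨x, r⟩` of `x ∈ N_ℝ` with `r ∈ M = Hom(N, ℤ)`. -/
def pairing (r : Module.Dual ℤ N) : RealSpace N →ₗ[ℝ] ℝ :=
  ((Algebra.linearMap ℤ ℝ).comp r).liftBaseChange ℝ

lemma pairing_add (r s : Module.Dual ℤ N) (x : RealSpace N) :
    pairing (r + s) x = pairing r x + pairing s x := by
  simp [pairing, LinearMap.comp_add]

lemma pairing_zero (x : RealSpace N) : pairing (0 : Module.Dual ℤ N) x = 0 := by
  simp [pairing]

lemma pairing_sub (r s : Module.Dual ℤ N) (x : RealSpace N) :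
    pairing (r - s) x = pairing r x - pairing s x := by
  have := pairing_add (r - s) s x
  rw [sub_add_cancel] at this
  linarith

namespace RationalCone

variable (σ : RationalCone N)

/-- `Λ = σ^∨ ∩ M`. -/
def latticePoints : Set (Module.Dual ℤ N) := {r | ∀ x ∈ σ.cone, 0 ≤ pairing r x}

/-- `Λ(R) = Λ + R`. -/
def shifted (R : Module.Dual ℤ N) : Set (Module.Dual ℤ N) := {r | r - R ∈ σ.latticePoints}

/-- The faces of `σ` of dimension `p`. -/
def Face (p : ℕ) : Type _ :=
  {τ : PointedCone ℝ (RealSpace N) //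
    τ.IsFaceOf σ.cone ∧ Module.finrank ℝ (Submodule.span ℝ (τ : Set (RealSpace N))) = p}

variable {σ}

/-- The linear span of a face. -/
abbrev Face.span {p : ℕ} (τ : σ.Face p) : Submodule ℝ (RealSpace N) :=
  Submodule.span ℝ (τ.1 : Set (RealSpace N))

lemma hull_inter_eq {s : Set (RealSpace N)} {τ : PointedCone ℝ (RealSpace N)}
    (h : τ.IsFaceOf (PointedCone.hull ℝ s)) :
    PointedCone.hull ℝ (s ∩ τ) = τ := by
  apply le_antisymm
  · exact Submodule.span_le.2 Set.inter_subset_right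
  · intro x hx
    have key : ∀ y ∈ PointedCone.hull ℝ s, y ∈ τ → y ∈ PointedCone.hull ℝ (s ∩ τ) := by
      intro y hy
      induction hy using Submodule.span_induction with
      | mem y hy => exact fun hyt => Submodule.subset_span ⟨hy, hyt⟩
      | zero => exact fun _ => Submodule.zero_mem _
      | add y z hy hz ihy ihz =>
        intro hyz
        have := (h.add_mem_iff_mem hy hz).1 hyz
        exact Submodule.add_mem _ (ihy this.1) (ihz this.2)
      | smul c y hy ih =>
        intro hcy
        rcases eq_or_ne c 0 with rfl | hc
        · rw [zero_smul]; exact Submodule.zero_mem _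
        · have hpos : (0 : ℝ) < c.1 := lt_of_le_of_ne c.2 fun h0 => hc (Subtype.ext h0.symm)
          have : c.1 • y + 0 ∈ τ := by rw [add_zero]; exact hcy
          exact Submodule.smul_mem _ _
            (ih (h.mem_of_smul_add_mem hy (Submodule.zero_mem _) hpos this))
    exact key x (h.le hx) hx

instance finite_face (p : ℕ) : Finite (σ.Face p) := by
  obtain ⟨s, hs⟩ := σ.rational
  set t : Set (RealSpace N) := (fun a : N => (1 : ℝ) ⊗ₜ[ℤ] a) '' (s : Set N) with ht
  have htf : t.Finite := s.finite_toSet.image _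
  have : Finite (t.powerset) := (htf.finite_subsets).to_subtype
  refine Finite.of_injective (β := t.powerset)
    (fun τ => ⟨t ∩ (τ.1 : Set (RealSpace N)), Set.inter_subset_left⟩) ?_
  intro τ τ' h
  have h' : t ∩ (τ.1 : Set (RealSpace N)) = t ∩ (τ'.1 : Set (RealSpace N)) :=
    congrArg Subtype.val h
  have key : ∀ C : PointedCone ℝ (RealSpace N), C.IsFaceOf σ.cone →
      PointedCone.hull ℝ (t ∩ C) = C := fun C hC => hull_inter_eq (by rw [← hs]; exact hC)
  have h1 := key _ τ.2.1
  have h2 := key _ τ'.2.1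
  apply Subtype.ext
  rw [← h1, ← h2, h']

/-- `K_τ^R = Λ ∩ (R - int τ^∨)`; since `τ` is a salient polyhedral cone, the interior of `τ^∨`
consists of the linear functions that are positive on `τ ∖ {0}`. In particular `K_0^R = Λ`. -/
def K (R : Module.Dual ℤ N) {p : ℕ} (τ : σ.Face p) : Set (Module.Dual ℤ N) :=
  {r | r ∈ σ.latticePoints ∧ ∀ x ∈ τ.1, x ≠ 0 → 0 < pairing (R - r) x}

variable (σ) in
/-- A choice of an orientation of every face, given by an ordered basis of its span. -/
abbrev Orientations : Type _ := ∀ (p : ℕ) (τ : σ.Face p), Module.Basis (Fin p) ℝ τ.span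

open Classical in
/-- The sign `[τ : τ']` comparing the orientations of a face `τ` and of a face `τ'` of one
dimension more: it is `0` unless `τ ≤ τ'`, and then it is `1` or `-1` according to whether the basis
of `τ`, followed by a vector of `τ'` which is not in the span of `τ`, is a positive or a negative
basis of the span of `τ'`. (All these vectors lie on the same side of the span of `τ`.) -/
def incidence (o : σ.Orientations) {p : ℕ} (τ : σ.Face p) (τ' : σ.Face (p + 1)) : ℤ :=
  if h : τ.span ≤ τ'.span ∧ τ.1 ≤ τ'.1 then
    if ∃ v : τ'.span, (v : RealSpace N) ∈ τ'.1 ∧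
        0 < (o (p + 1) τ').det (Fin.snoc (fun j => Submodule.inclusion h.1 (o p τ j)) v)
      then 1 else -1
  else 0

end RationalCone

end Cones

/-! ### The double complex `C^q(K_p^R; k)` and its total complex -/

section Total

variable {N : Type*} [AddCommGroup N] (k : Type*) [Field k] (σ : RationalCone N)
  (R : Module.Dual ℤ N)

/-- The sum over the `p`-dimensional faces `τ` of the spaces of all functions `S_q(K_τ^R) → k`. -/
abbrev DoubleComplex (p q : ℕ) : Type _ :=
  ∀ τ : σ.Face p, Cochain k (RationalCone.K R τ) q

/-- The product of all the terms of the double complex. -/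
abbrev BigradedSpace : Type _ := ∀ p q : ℕ, DoubleComplex k σ R p q

variable {k σ R}

/-- The horizontal differential `δ : C^q(K_p^R) → C^q(K_{p+1}^R)`: the signed sum of the
restriction maps. -/
def horizontal (o : σ.Orientations) (p q : ℕ) :
    DoubleComplex k σ R p q →ₗ[k] DoubleComplex k σ R (p + 1) q where
  toFun x := fun τ' =>
    ∑ᶠ τ : σ.Face p, (RationalCone.incidence o τ τ') • res (RationalCone.K R τ') (x τ)
  map_add' x y := by
    funext τ'
    simp only [Pi.add_apply, map_add, smul_add]
    exact finsum_add_distrib (Set.toFinite _) (Set.toFinite _)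
  map_smul' c x := by
    funext τ'
    simp only [Pi.smul_apply, map_smul, RingHom.id_apply]
    rw [smul_finsum' c (Set.toFinite _)]
    exact finsum_congr fun τ => smul_comm _ _ _

/-- The vertical differential, induced by `d` on every face. -/
def vertical (p q : ℕ) : DoubleComplex k σ R p q →ₗ[k] DoubleComplex k σ R p (q + 1) where
  toFun x := fun τ => diff q (x τ)
  map_add' x y := by funext τ; simp
  map_smul' c x := by funext τ; simp

/-- The total differential `D = δ + (-1)^p d`. -/
def totalDiff (o : σ.Orientations) : BigradedSpace k σ R →ₗ[k] BigradedSpace k σ R where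
  toFun x := fun p q =>
    (match p with
      | 0 => 0
      | p + 1 => horizontal o p q (x p q)) +
    (-1 : k) ^ p • (match q with
      | 0 => 0
      | q + 1 => vertical p q (x p q))
  map_add' x y := by
    funext p q
    rcases p with _ | p <;> rcases q with _ | q <;>
      simp only [Pi.add_apply, map_add, smul_add, smul_zero, add_zero] <;> abel
  map_smul' c x := by
    funext p q
    rcases p with _ | p <;> rcases q with _ | q <;>
      simp only [Pi.smul_apply, map_smul, smul_add, smul_zero, add_zero, RingHom.id_apply,
        smul_comm c ((-1 : k) ^ _)]

variable (k σ R) in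
/-- The term of degree `n` of the total complex of `C^•_{(i)}(K_•^R; k)`: the bigraded elements
concentrated in bidegrees `(p, q)` with `p + q = n`, and with components in
`C^q_{(i)}(K_τ^R; k) = C^q_{(i)}(K_τ^R, ∅; k)` (zero for `q < i`). -/
def total (i n : ℕ) : Submodule k (BigradedSpace k σ R) where
  carrier := {x | (∀ p q, p + q ≠ n → x p q = 0) ∧
    ∀ p q (τ : σ.Face p), x p q τ ∈ hodge k i q (RationalCone.K R τ) ∅}
  zero_mem' := ⟨fun _ _ _ => rfl, fun _ _ _ => Submodule.zero_mem _⟩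
  add_mem' hx hy := ⟨fun p q h => by
      rw [Pi.add_apply, Pi.add_apply, hx.1 p q h, hy.1 p q h, add_zero],
    fun p q τ => Submodule.add_mem _ (hx.2 p q τ) (hy.2 p q τ)⟩
  smul_mem' c _ hx := ⟨fun p q h => by
      rw [Pi.smul_apply, Pi.smul_apply, hx.1 p q h, smul_zero],
    fun p q τ => Submodule.smul_mem _ c (hx.2 p q τ)⟩

variable (k R) in
/-- The cocycles of degree `n` of the total complex. -/
def totalCocycles (o : σ.Orientations) (i n : ℕ) : Submodule k (BigradedSpace k σ R) :=
  total k σ R i n ⊓ LinearMap.ker (totalDiff o)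

variable (k R) in
/-- The coboundaries of degree `n + 1` of the total complex. -/
def totalCoboundaries (o : σ.Orientations) (i n : ℕ) : Submodule k (BigradedSpace k σ R) :=
  (total k σ R i n).map (totalDiff o)

variable (k R) in
/-- `H^{n+1}(tot^•(C^•_{(i)}(K_•^R; k)))`. -/
abbrev TotalCohomology (o : σ.Orientations) (i n : ℕ) : Type _ :=
  totalCocycles k R o i (n + 1) ⧸
    (totalCoboundaries k R o i n).submoduleOf (totalCocycles k R o i (n + 1))

/-- The element of the double complex with the component `x` in bidegree `(p, q)` and all other
components zero. -/
def inBidegree (p q : ℕ) : DoubleComplex k σ R p q →ₗ[k] BigradedSpace k σ R :=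
  (LinearMap.single k (fun p => ∀ q : ℕ, DoubleComplex k σ R p q) p).comp
    (LinearMap.single k (fun q => DoubleComplex k σ R p q) q)

variable (R) in
/-- A cochain on `Λ` as an element of `C^q(K_0^R; k)`; recall that `K_0^R = Λ`. -/
def onVertex (q : ℕ) : Cochain k σ.latticePoints q →ₗ[k] DoubleComplex k σ R 0 q where
  toFun φ := fun τ => res (RationalCone.K R τ) φ
  map_add' φ ψ := by funext τ; simp
  map_smul' c φ := by funext τ; simp

lemma onVertex_mem_zero {p : ℕ} {τ' : σ.Face (p + 1)} {r : Module.Dual ℤ N}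
    (hr : r ∈ RationalCone.K R τ') : r ∈ σ.latticePoints \ σ.shifted R := by
  refine ⟨hr.1, fun hs => ?_⟩
  have hne : ∃ x ∈ τ'.1, x ≠ 0 := by
    by_contra hcon
    push Not at hcon
    have hbot : τ'.span = ⊥ := Submodule.span_eq_bot.2 hcon
    have h2 := τ'.2.2
    rw [show Submodule.span ℝ (τ'.1 : Set (RealSpace N)) = ⊥ from hbot, finrank_bot] at h2
    omega
  obtain ⟨x, hx, hx0⟩ := hne
  have h1 := hr.2 x hx hx0
  have h2 := hs x (τ'.2.1.le hx)
  rw [pairing_sub] at h1 h2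
  linarith

lemma pairing_sum {n : ℕ} (v : Fin n → Module.Dual ℤ N) (x : RealSpace N) :
    pairing (∑ j, v j) x = ∑ j, pairing (v j) x :=
  map_sum (AddMonoidHom.mk' (fun r : Module.Dual ℤ N => pairing r x)
    fun r s => pairing_add r s x) v Finset.univ

lemma latticePoints_add {r s : Module.Dual ℤ N} (hr : r ∈ σ.latticePoints)
    (hs : s ∈ σ.latticePoints) : r + s ∈ σ.latticePoints := fun x hx => by
  rw [pairing_add]; exact add_nonneg (hr x hx) (hs x hx)

lemma K_of_le {p : ℕ} {τ : σ.Face p} {r s : Module.Dual ℤ N} (hr : r ∈ σ.latticePoints)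
    (hs : s ∈ RationalCone.K R τ) (h : s - r ∈ σ.latticePoints) : r ∈ RationalCone.K R τ := by
  refine ⟨hr, fun x hx hx0 => ?_⟩
  have h1 := hs.2 x hx hx0
  have h2 := h x (τ.2.1.le hx)
  rw [pairing_sub] at h1 h2 ⊢
  linarith

lemma tuples_of_le {p m n : ℕ} {τ : σ.Face p} {v : Fin m → Module.Dual ℤ N}
    (hv : v ∈ tuples (RationalCone.K R τ) m) {w : Fin n → Module.Dual ℤ N}
    (hw : ∀ j, w j ∈ σ.latticePoints) (h : ∑ j, v j - ∑ j, w j ∈ σ.latticePoints) :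
    w ∈ tuples (RationalCone.K R τ) n := by
  have hsum : ∑ j, w j ∈ σ.latticePoints := fun x hx => by
    rw [pairing_sum]
    exact Finset.sum_nonneg fun j _ => hw j x hx
  have hK := K_of_le hsum hv.2 h
  refine ⟨fun j => K_of_le (hw j) hK fun x hx => ?_, hK⟩
  rw [pairing_sub, pairing_sum, sub_nonneg]
  exact Finset.single_le_sum (f := fun j => pairing (w j) x)
    (fun j _ => hw j x hx) (Finset.mem_univ j)

lemma sum_contractNth {M : Type*} [AddCommGroup M] {n : ℕ} (j : Fin (n + 1))
    (v : Fin (n + 1) → M) :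
    ∑ a, Fin.contractNth j (· + ·) v a + (if j = Fin.last n then v (Fin.last n) else 0) =
      ∑ a, v a := by
  induction n with
  | zero =>
    have : j = Fin.last 0 := Fin.ext (by have := j.2; simp only [Fin.val_last]; omega)
    simp [this]
  | succ n ih =>
    refine Fin.cases ?_ (fun j => ?_) j
    · have h0 : (0 : Fin (n + 2)) ≠ Fin.last (n + 1) := (Fin.last_pos).ne
      rw [if_neg h0, Fin.sum_univ_succ, Fin.sum_univ_succ (n := n + 1), Fin.sum_univ_succ (n := n)]
      simp [Fin.contractNth, add_assoc]
    · have key := ih j (fun a => v a.succ)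
      rw [Fin.sum_univ_succ, Fin.sum_univ_succ (n := n + 1), ← key]
      have e1 : Fin.contractNth j.succ (· + ·) v 0 = v 0 := by simp [Fin.contractNth]
      have e2 : ∀ a : Fin n, Fin.contractNth j.succ (· + ·) v a.succ =
          Fin.contractNth j (· + ·) (fun a => v a.succ) a := fun a => by
        simp [Fin.contractNth]
      have e3 : (j.succ = Fin.last (n + 1)) ↔ (j = Fin.last n) := by
        rw [← Fin.succ_last]; exact Fin.succ_inj
      rw [e1]
      simp only [e2, e3, Fin.succ_last]
      rw [add_assoc]

lemma contractNth_mem {p n : ℕ} {τ : σ.Face p} {v : Fin (n + 1) → Module.Dual ℤ N}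
    (hv : v ∈ tuples (RationalCone.K R τ) (n + 1)) (j : Fin (n + 1)) :
    Fin.contractNth j (· + ·) v ∈ tuples (RationalCone.K R τ) n := by
  have hΛ : ∀ a, v a ∈ σ.latticePoints := fun a => (hv.1 a).1
  refine tuples_of_le hv (fun a => ?_) ?_
  · unfold Fin.contractNth
    split_ifs
    · exact hΛ _
    · exact latticePoints_add (hΛ _) (hΛ _)
    · exact hΛ _
  · rw [← sum_contractNth j v, add_sub_cancel_left]
    split_ifs
    · exact hΛ _
    · exact fun x _ => (pairing_zero x).ge

lemma tail_mem {p n : ℕ} {τ : σ.Face p} {v : Fin (n + 1) → Module.Dual ℤ N}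
    (hv : v ∈ tuples (RationalCone.K R τ) (n + 1)) :
    (fun a : Fin n => v a.succ) ∈ tuples (RationalCone.K R τ) n := by
  refine tuples_of_le hv (fun a => (hv.1 _).1) ?_
  rw [Fin.sum_univ_succ, add_sub_cancel_right]
  exact (hv.1 0).1

lemma ev_res {M : Type*} [AddCommGroup M] {P P' : Set M} {n : ℕ} (φ : Cochain k P n)
    {v : Fin n → M} (hv : v ∈ tuples P' n) : ev (res P' φ) v = ev φ v := by
  rw [ev_of_mem _ hv]; rfl

lemma K_tuples_subset {p n : ℕ} {τ : σ.Face p} {v : Fin n → Module.Dual ℤ N}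
    (hv : v ∈ tuples (RationalCone.K R τ) n) : v ∈ tuples σ.latticePoints n :=
  ⟨fun j => (hv.1 j).1, hv.2.1⟩

lemma res_diff {p n : ℕ} (τ : σ.Face p) (φ : Cochain k σ.latticePoints n) :
    res (RationalCone.K R τ) (diff n φ) = diff n (res (RationalCone.K R τ) φ) := by
  funext v
  change ev (diff n φ) v.1 = _
  rw [ev_of_mem _ (K_tuples_subset v.2)]
  simp only [diff, LinearMap.coe_mk, AddHom.coe_mk]
  rw [ev_res φ (tail_mem v.2)]
  congr 1
  refine Finset.sum_congr rfl fun j _ => ?_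
  rw [ev_res φ (contractNth_mem v.2 j)]

lemma res_hodge {i p n : ℕ} (τ : σ.Face p) {Q : Set (Module.Dual ℤ N)}
    {φ : Cochain k σ.latticePoints n} (hφ : φ ∈ hodge k i n σ.latticePoints Q) :
    res (RationalCone.K R τ) φ ∈ hodge k i n (RationalCone.K R τ) ∅ := by
  obtain ⟨h0, h1, -⟩ := hφ
  refine ⟨fun h => by rw [h0 h, map_zero], fun v => ?_, fun v hv => absurd hv.2 (by simp)⟩
  have hv := K_tuples_subset v.2
  have := h1 ⟨v.1, hv⟩
  change _ = _ * ev φ v.1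
  rw [ev_of_mem φ hv, ← this]
  refine Finset.sum_congr rfl fun r _ => Finset.sum_congr rfl fun π _ => ?_
  split_ifs
  · rw [ev_res φ]
    refine ⟨fun j => v.2.1 _, ?_⟩
    have := v.2.2
    rwa [Equiv.sum_comp (π⁻¹ : Equiv.Perm (Fin n)) v.1]
  · rfl

lemma horizontal_onVertex {i n : ℕ} (o : σ.Orientations) {φ : Cochain k σ.latticePoints n}
    (hφ : φ ∈ hodge k i n σ.latticePoints (σ.latticePoints \ σ.shifted R)) :
    horizontal o 0 n (onVertex R n φ) = 0 := by
  funext τ'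
  change ∑ᶠ τ : σ.Face 0, _ = _
  refine finsum_eq_zero_of_forall_eq_zero fun τ => ?_
  have : res (RationalCone.K R τ') (onVertex R n φ τ) = 0 := by
    funext v
    change ev (res (RationalCone.K R τ) φ) v.1 = 0
    by_cases hv : v.1 ∈ tuples (RationalCone.K R τ) n
    · rw [ev_res φ hv, ev_of_mem φ (K_tuples_subset v.2)]
      exact hφ.2.2 _ ⟨fun j => onVertex_mem_zero (v.2.1 j), onVertex_mem_zero v.2.2⟩
    · exact dif_neg hv
  rw [this, smul_zero]

lemma totalDiff_onVertex (o : σ.Orientations) {n : ℕ} {φ : Cochain k σ.latticePoints n}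
    (h : horizontal o 0 n (onVertex R n φ) = 0) :
    totalDiff o (inBidegree 0 n (onVertex R n φ)) =
      inBidegree 0 (n + 1) (onVertex R (n + 1) (diff n φ)) := by
  funext p q
  rcases p with _ | p
  · rcases q with _ | q
    · simp [totalDiff, inBidegree]
    · by_cases hq : q = n
      · subst hq
        funext τ
        simp [totalDiff, inBidegree, vertical, onVertex, res_diff]
      · simp [totalDiff, inBidegree, hq]
  · rcases p with _ | p
    · by_cases hq : q = n
      · subst hq
        rcases q with _ | q <;> simp [totalDiff, inBidegree, h]
      · rcases q with _ | q <;> simp [totalDiff, inBidegree, hq]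
    · rcases q with _ | q <;> simp [totalDiff, inBidegree]

lemma onVertex_mem_total {i n : ℕ} {Q : Set (Module.Dual ℤ N)}
    {φ : Cochain k σ.latticePoints n} (hφ : φ ∈ hodge k i n σ.latticePoints Q) :
    inBidegree 0 n (onVertex R n φ) ∈ total k σ R i n := by
  refine ⟨fun p q h => ?_, fun p q τ => ?_⟩
  · by_cases hp : p = 0
    · subst hp
      have hq : q ≠ n := fun e => h (by rw [e, zero_add])
      simp [inBidegree, hq]
    · simp [inBidegree, hp]
  · by_cases hp : p = 0
    · subst hp
      by_cases hq : q = n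
      · subst hq
        simpa [inBidegree, onVertex] using res_hodge τ hφ
      · have : inBidegree 0 n (onVertex R n φ) 0 q τ = 0 := by simp [inBidegree, hq]
        rw [this]; exact Submodule.zero_mem _
    · have : inBidegree 0 n (onVertex R n φ) p q τ = 0 := by simp [inBidegree, hp]
      rw [this]; exact Submodule.zero_mem _

lemma onVertex_mem_totalCocycles (o : σ.Orientations) {i n : ℕ}
    {φ : Cochain k σ.latticePoints n}
    (hφ : φ ∈ cocycles k i n σ.latticePoints (σ.latticePoints \ σ.shifted R)) :
    inBidegree 0 n (onVertex R n φ) ∈ totalCocycles k R o i n := by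
  refine ⟨onVertex_mem_total hφ.1, ?_⟩
  have hd : diff n φ = 0 := hφ.2
  change totalDiff o _ = 0
  rw [totalDiff_onVertex o (horizontal_onVertex o hφ.1), hd, map_zero, map_zero]

/-- The canonical map `C^n_{(i)}(Λ, Λ ∖ Λ(R); k) → tot^n(C^•_{(i)}(K_•^R; k))` on cocycles, induced
by the inclusion into `C^n_{(i)}(Λ; k) = C^n_{(i)}(K_0^R; k)`. -/
def cocyclesToTotal (o : σ.Orientations) (i n : ℕ) :
    cocycles k i n σ.latticePoints (σ.latticePoints \ σ.shifted R) →ₗ[k]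
      totalCocycles k R o i n :=
  ((inBidegree 0 n).comp (onVertex R n)).restrict fun _ hφ => onVertex_mem_totalCocycles o hφ

variable (k R) in
/-- The canonical map `H^{n+1}_{(i)}(Λ, Λ ∖ Λ(R); k) → H^{n+1}(tot^•(C^•_{(i)}(K_•^R; k)))`, sending
the class of a cocycle `φ` to the class of `φ`, placed in `C^{n+1}_{(i)}(K_0^R; k)`. -/
def toTotal (o : σ.Orientations) (i n : ℕ) :
    Cohomology k i n σ.latticePoints (σ.latticePoints \ σ.shifted R) →ₗ[k]
      TotalCohomology k R o i n :=
  Submodule.mapQ _ _ (cocyclesToTotal o i (n + 1)) (by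
    rintro ⟨φ, hφ⟩ hmem
    obtain ⟨ψ, hψ, hψφ⟩ := hmem
    refine ⟨inBidegree 0 n (onVertex R n ψ), onVertex_mem_total hψ, ?_⟩
    rw [totalDiff_onVertex o (horizontal_onVertex o hψ), hψφ]
    rfl)

end Total

/-! ### The Gerstenhaber product and the cochain `B` -/

section Product

variable {N : Type*} [AddCommGroup N] {k : Type*} [Field k] {σ : RationalCone N}

/-- The Gerstenhaber product `[f, g]` of a 2-cochain `f` of degree `-R` and a 2-cochain `g` of
degree `-S`, as a function of `(λ₁, λ₂, λ₃)`. -/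
def bracket (R S : Module.Dual ℤ N) (f g : Cochain k σ.latticePoints 2) :
    Cochain k σ.latticePoints 3 := fun v =>
  ev f ![-S + v.1 0 + v.1 1, v.1 2] * ev g ![v.1 0, v.1 1]
    - ev f ![v.1 0, -S + v.1 1 + v.1 2] * ev g ![v.1 1, v.1 2]
    + ev g ![-R + v.1 0 + v.1 1, v.1 2] * ev f ![v.1 0, v.1 1]
    - ev g ![v.1 0, -R + v.1 1 + v.1 2] * ev f ![v.1 1, v.1 2]

/-- The extension by zero `μ⁰ ∈ C^1(Λ; k)` of `μ ∈ C^1(Λ ∖ Λ(S); k)`. -/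
def extendZero {S : Module.Dual ℤ N} (μ : Cochain k (σ.latticePoints \ σ.shifted S) 1) :
    Cochain k σ.latticePoints 1 := res σ.latticePoints μ

/-- `B = B₁ - B₂`, where
`B₁(λ₁, λ₂) = ξ(-S + λ₁ + λ₂, λ₂) μ⁰(λ₁) + ξ(λ₁, -S + λ₁ + λ₂) μ⁰(λ₂)` and
`B₂(λ₁, λ₂) = ξ(λ₁, λ₂) μ⁰(λ₁ + λ₂ - R)`; values of `ξ` and of `μ⁰` at arguments outside `Λ`
are read as `0`. -/
def cochainB (R S : Module.Dual ℤ N) (μ : Cochain k (σ.latticePoints \ σ.shifted S) 1)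
    (ξ : Cochain k σ.latticePoints 2) : Cochain k σ.latticePoints 2 := fun v =>
  (ev ξ ![-S + v.1 0 + v.1 1, v.1 1] * ev (extendZero μ) ![v.1 0]
      + ev ξ ![v.1 0, -S + v.1 0 + v.1 1] * ev (extendZero μ) ![v.1 1])
    - ev ξ ![v.1 0, v.1 1] * ev (extendZero μ) ![v.1 0 + v.1 1 - R]

end Product

end

end ToricHochschild

/-! Let `D` be the total differential. Placed at the vertex, `B` has `D B = (δB, dB)`, so with `g =
[dμ⁰, ξ]` the element `z = (δB, dB - g)` is `D B - g`. Modulo coboundaries it is `-g`, and the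
formula for `B` matters only through its antisymmetry, which places `B` in the piece `i = 2`. What
remains is to check that `g` and `z` are cocycles in the right spaces and that the canonical map is
injective.

For `g`: each half of the Gerstenhaber product has as coboundary a difference of two products of
values of `f` and `g` (`insertion_coboundary`), and the two halves cancel. A symmetric and an
antisymmetric factor give a product invariant under reversal, which puts it in the piece `i = 2`
(`mem_hodge_two_three`). Its vanishing on `Λ ∖ Λ(R + S)` follows from the supports of the factors
(`mem_of_ev_ne_zero`).

For `z`: `D (D B) = 0` needs `δδ = 0` on vertex cochains. This reduces to a signed count of the rays
of a two-dimensional face: there are exactly two, and they contribute opposite signs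
(`sum_incidence_mul_incidence_apex`).

For injectivity: since `C^q_{(n)} = 0` for `q < n`, the total complex of the piece `i = n` consists
in degree `n` of vertex cochains alone. If `D ψ = φ` with `φ` at the vertex, then `δψ = 0`. As the
sets `K_τ` of the rays cover `Λ ∖ Λ(R)`, `ψ` is a relative cochain, and `dψ = φ`. -/

namespace ToricHochschild

noncomputable section

/-! ### Extreme rays of finitely generated salient cones -/

section ConeGeometry

variable {E : Type*} [AddCommGroup E] [Module ℝ E]

lemma eq_zero_of_add_eq_zero {C : PointedCone ℝ E} (hC : (C : ConvexCone ℝ E).Salient)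
    {x y : E} (hx : x ∈ C) (hy : y ∈ C) (h : x + y = 0) : x = 0 := by
  by_contra hne
  refine hC x hx hne ?_
  rw [neg_eq_of_add_eq_zero_right h]
  exact hy

lemma mem_hull_singleton {a x : E} :
    x ∈ PointedCone.hull ℝ {a} ↔ ∃ t : ℝ, 0 ≤ t ∧ t • a = x := by
  refine Submodule.mem_span_singleton.trans ⟨?_, ?_⟩
  · rintro ⟨t, rfl⟩
    exact ⟨t, t.2, rfl⟩
  · rintro ⟨t, ht, rfl⟩
    exact ⟨⟨t, ht⟩, rfl⟩

/-- A generator of a salient cone that is not in the cone generated by the other ones spans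
an extreme ray. -/
lemma isFaceOf_hull_singleton {s : Set E} {a : E}
    (hC : (PointedCone.hull ℝ (insert a s) : ConvexCone ℝ E).Salient)
    (ha : a ∉ PointedCone.hull ℝ s) :
    (PointedCone.hull ℝ {a}).IsFaceOf (PointedCone.hull ℝ (insert a s)) := by
  have hsub : PointedCone.hull ℝ s ≤ PointedCone.hull ℝ (insert a s) :=
    Submodule.span_mono (Set.subset_insert _ _)
  have haC : a ∈ PointedCone.hull ℝ (insert a s) := Submodule.subset_span (Set.mem_insert _ _)
  refine ⟨Submodule.span_mono (by simp), fun {x y c} hx hy hc hxy => ?_⟩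
  obtain ⟨α, u, hu, rfl⟩ := Submodule.mem_span_insert.1 hx
  obtain ⟨β, v, hv, rfl⟩ := Submodule.mem_span_insert.1 hy
  obtain ⟨t, ht, hte⟩ := mem_hull_singleton.1 hxy
  change t • a = c • (α.1 • a + u) + (β.1 • a + v) at hte
  have hcu : c • u ∈ PointedCone.hull ℝ s := PointedCone.smul_mem _ hc.le hu
  -- The coefficient of `a` decides everything: if positive, `a` would lie in the cone over `s`.
  -- Otherwise `c • u + v` has its negative in the cone, so salience makes it zero, and then `u =
  -- 0`.
  have hw : c • u + v ∈ PointedCone.hull ℝ s := add_mem hcu hv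
  have hrel : (t - c * α.1 - β.1) • a = c • u + v := by
    rw [sub_smul, sub_smul, hte, smul_add, smul_smul]
    abel
  have hκ : t - c * α.1 - β.1 ≤ 0 := by
    by_contra! hpos
    refine ha ?_
    have := PointedCone.smul_mem _ (inv_nonneg.2 hpos.le) hw
    rwa [← hrel, smul_smul, inv_mul_cancel₀ hpos.ne', one_smul] at this
  have hzero : c • u + v = 0 := by
    refine eq_zero_of_add_eq_zero hC (hsub hw)
      (PointedCone.smul_mem _ (neg_nonneg.2 hκ) haC) ?_
    rw [← hrel, neg_smul, add_neg_cancel]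
  have hu0 : u = 0 := by
    have := eq_zero_of_add_eq_zero hC (hsub hcu) (hsub hv) hzero
    exact (smul_eq_zero.1 this).resolve_left hc.ne'
  rw [hu0, add_zero]
  exact mem_hull_singleton.2 ⟨α.1, α.2, rfl⟩

/-- A finitely generated salient cone is generated by its extreme rays. -/
lemma exists_extreme_generators (s : Finset E)
    (hC : (PointedCone.hull ℝ (s : Set E) : ConvexCone ℝ E).Salient) :
    ∃ t : Finset E, PointedCone.hull ℝ (t : Set E) = PointedCone.hull ℝ (s : Set E) ∧
      ∀ a ∈ t, a ≠ 0 ∧ (PointedCone.hull ℝ {a}).IsFaceOf (PointedCone.hull ℝ (s : Set E)) := by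
  classical
  induction s using Finset.strongInduction with
  | H s ih =>
    -- Redundant generators are discarded until none is left; each remaining one then spans an
    -- extreme ray.
    by_cases h : ∃ a ∈ s, a ∈ PointedCone.hull ℝ ((s.erase a : Finset E) : Set E)
    · obtain ⟨a, ha, hmem⟩ := h
      have heq : PointedCone.hull ℝ ((s.erase a : Finset E) : Set E) =
          PointedCone.hull ℝ (s : Set E) := by
        rw [← Finset.insert_erase ha, Finset.coe_insert, Finset.erase_insert (by simp)]
        exact (Submodule.span_insert_eq_span hmem).symm
      rw [← heq]
      exact ih _ (Finset.erase_ssubset ha) (by rw [heq]; exact hC)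
    · push Not at h
      refine ⟨s, rfl, fun a ha => ⟨?_, ?_⟩⟩
      · rintro rfl
        exact h 0 ha (Submodule.zero_mem _)
      · have heq : (s : Set E) = insert a ((s.erase a : Finset E) : Set E) := by
          rw [← Finset.coe_insert, Finset.insert_erase ha]
        rw [heq] at hC ⊢
        exact isFaceOf_hull_singleton hC (h a ha)

lemma span_hull (s : Set E) :
    Submodule.span ℝ (PointedCone.hull ℝ s : Set E) = Submodule.span ℝ s :=
  Submodule.span_span_of_tower _ _ _

lemma finrank_span_hull_singleton {a : E} (ha : a ≠ 0) :
    Module.finrank ℝ (Submodule.span ℝ (PointedCone.hull ℝ {a} : Set E)) = 1 := by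
  rw [span_hull, finrank_span_singleton ha]

/-! #### Salient cones in a plane -/

variable (f₀ f₁ : E →ₗ[ℝ] ℝ)

/-- The determinant of two vectors of a plane with coordinate functions `f₀`, `f₁`. -/
def planeDet (x y : E) : ℝ := f₀ x * f₁ y - f₁ x * f₀ y

lemma planeDet_swap (x y : E) : planeDet f₁ f₀ x y = -planeDet f₀ f₁ x y := by
  unfold planeDet; ring

lemma planeDet_comm (x y : E) : planeDet f₀ f₁ x y = -planeDet f₀ f₁ y x := by
  unfold planeDet; ring

variable {f₀ f₁} {C : PointedCone ℝ E}
  (hf : ∀ x ∈ Submodule.span ℝ (C : Set E), f₀ x = 0 → f₁ x = 0 → x = 0)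
include hf

/-- The vectors `f₀ x • y - f₀ y • x` and `f₁ x • y - f₁ y • x` are killed by both functionals,
hence vanish, and one can divide by a nonzero coordinate of `x`. The functionals live on all of `E`
and separate points only on the span of `C`, so no passage to a subspace is needed. -/
lemma exists_smul_of_planeDet_eq_zero {x y : E} (hx : x ∈ C) (hy : y ∈ C) (hx0 : x ≠ 0)
    (h : planeDet f₀ f₁ x y = 0) : ∃ t : ℝ, y = t • x := by
  have hx' := Submodule.subset_span (R := ℝ) (s := (C : Set E)) hx
  have hy' := Submodule.subset_span (R := ℝ) (s := (C : Set E)) hy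
  unfold planeDet at h
  have e0 : f₀ x • y - f₀ y • x = 0 :=
    hf _ (sub_mem (Submodule.smul_mem _ _ hy') (Submodule.smul_mem _ _ hx'))
      (by simp; ring) (by simp; linarith)
  have e1 : f₁ x • y - f₁ y • x = 0 :=
    hf _ (sub_mem (Submodule.smul_mem _ _ hy') (Submodule.smul_mem _ _ hx'))
      (by simp; linarith) (by simp; ring)
  by_cases h0 : f₀ x = 0
  · have h1 : f₁ x ≠ 0 := fun h1 => hx0 (hf x hx' h0 h1)
    refine ⟨(f₁ x)⁻¹ * f₁ y, ?_⟩
    rw [mul_smul, ← sub_eq_zero.1 e1, smul_smul, inv_mul_cancel₀ h1, one_smul]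
  · refine ⟨(f₀ x)⁻¹ * f₀ y, ?_⟩
    rw [mul_smul, ← sub_eq_zero.1 e0, smul_smul, inv_mul_cancel₀ h0, one_smul]

lemma mem_hull_of_planeDet_eq_zero (hC : (C : ConvexCone ℝ E).Salient) {x y : E} (hx : x ∈ C)
    (hy : y ∈ C) (hx0 : x ≠ 0) (h : planeDet f₀ f₁ x y = 0) : y ∈ PointedCone.hull ℝ {x} := by
  obtain ⟨t, rfl⟩ := exists_smul_of_planeDet_eq_zero hf hx hy hx0 h
  rcases le_or_gt 0 t with ht | ht
  · exact mem_hull_singleton.2 ⟨t, ht, rfl⟩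
  · have : t • x = 0 := eq_zero_of_add_eq_zero hC hy
      (PointedCone.smul_mem _ (neg_nonneg.2 ht.le) hx) (by rw [neg_smul, add_neg_cancel])
    rw [this]
    exact Submodule.zero_mem _

/-- A plane salient cone lies on one side of each of its extreme rays. -/
lemma planeDet_nonneg_or_nonpos (hC : (C : ConvexCone ℝ E).Salient) {a : E} (ha : a ≠ 0)
    (hface : (PointedCone.hull ℝ {a}).IsFaceOf C) :
    (∀ v ∈ C, 0 ≤ planeDet f₀ f₁ a v) ∨ (∀ v ∈ C, planeDet f₀ f₁ a v ≤ 0) := by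
  by_contra! h
  obtain ⟨⟨v, hv, hv'⟩, ⟨w, hw, hw'⟩⟩ := h
  have haC : a ∈ C := hface.le (Submodule.subset_span rfl)
  -- This positive combination of vectors on opposite sides has determinant zero with `a`, so it
  -- lies on the ray of `a`. Extremality then forces `v` onto that ray, against the strict sign.
  have hvw : planeDet f₀ f₁ a w • v + (-planeDet f₀ f₁ a v) • w ∈ C :=
    add_mem (PointedCone.smul_mem _ hw'.le hv)
      (PointedCone.smul_mem _ (neg_nonneg.2 hv'.le) hw)
  have hmem := mem_hull_of_planeDet_eq_zero hf hC haC hvw ha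
    (by unfold planeDet; simp; ring)
  have hva := hface.mem_of_smul_add_mem hv
    (PointedCone.smul_mem _ (neg_nonneg.2 hv'.le) hw) hw' hmem
  obtain ⟨t, -, rfl⟩ := mem_hull_singleton.1 hva
  have : planeDet f₀ f₁ a (t • a) = 0 := by unfold planeDet; simp; ring
  exact hv'.ne this

/-- Each vector lies on the nonnegative side of the other, so antisymmetry makes their determinant
zero. Applied in both directions, this shows that at most one ray has the cone on its nonnegative
side. -/
lemma hull_le_of_planeDet_nonneg (hC : (C : ConvexCone ℝ E).Salient) {a b : E} (haC : a ∈ C)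
    (hbC : b ∈ C) (ha : a ≠ 0) (hpa : ∀ v ∈ C, 0 ≤ planeDet f₀ f₁ a v)
    (hpb : ∀ v ∈ C, 0 ≤ planeDet f₀ f₁ b v) :
    PointedCone.hull ℝ {b} ≤ PointedCone.hull ℝ {a} := by
  refine Submodule.span_le.2 (Set.singleton_subset_iff.2 ?_)
  refine mem_hull_of_planeDet_eq_zero hf hC haC hbC ha (le_antisymm ?_ (hpa b hbC))
  rw [planeDet_comm]
  linarith [hpb a haC]

/-- If the cone lay on the nonnegative side of every extreme ray, all extreme generators would lie
on a single ray and the span would have dimension at most one. Exchanging `f₀` and `f₁` yields a ray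
of the other kind. -/
lemma exists_ray_planeDet_nonpos (hC : (C : ConvexCone ℝ E).Salient) {s : Finset E}
    (hs : PointedCone.hull ℝ (s : Set E) = C)
    (hrank : Module.finrank ℝ (Submodule.span ℝ (C : Set E)) = 2) :
    ∃ a : E, a ≠ 0 ∧ (PointedCone.hull ℝ {a}).IsFaceOf C ∧
      (∀ v ∈ C, planeDet f₀ f₁ a v ≤ 0) := by
  subst hs
  obtain ⟨t, hts, ht⟩ := exists_extreme_generators s hC
  by_contra! hcon
  have hpos : ∀ a ∈ t, ∀ v ∈ PointedCone.hull ℝ (s : Set E), 0 ≤ planeDet f₀ f₁ a v := by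
    intro a ha
    refine (planeDet_nonneg_or_nonpos hf hC (ht a ha).1 (ht a ha).2).resolve_right fun h => ?_
    obtain ⟨v, hv, hv'⟩ := hcon a (ht a ha).1 (ht a ha).2
    exact absurd (h v hv) (not_le.2 hv')
  have hmem : ∀ a ∈ t, a ∈ PointedCone.hull ℝ (s : Set E) := fun a ha =>
    (ht a ha).2.le (Submodule.subset_span rfl)
  rcases t.eq_empty_or_nonempty with rfl | ⟨a, ha⟩
  · rw [← hts, span_hull] at hrank
    rw [Finset.coe_empty, Submodule.span_empty, finrank_bot] at hrank
    omega
  · have hle : PointedCone.hull ℝ (s : Set E) = PointedCone.hull ℝ {a} := by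
      refine le_antisymm ?_ (ht a ha).2.le
      rw [← hts]
      refine Submodule.span_le.2 fun b hb => ?_
      exact hull_le_of_planeDet_nonneg hf hC (hmem a ha) (hmem b hb) (ht a ha).1 (hpos a ha)
        (hpos b hb) (Submodule.subset_span rfl)
    rw [hle, finrank_span_hull_singleton (ht a ha).1] at hrank
    omega

end ConeGeometry

/-! ### Faces of dimension at most two and their incidence signs -/

namespace RationalCone

variable {N : Type*} [AddCommGroup N] {σ : RationalCone N}

lemma salient_of_isFaceOf {τ : PointedCone ℝ (RealSpace N)} (h : τ.IsFaceOf σ.cone) :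
    (τ : ConvexCone ℝ (RealSpace N)).Salient :=
  ConvexCone.Salient.anti (fun _ hx => h.le hx) σ.salient

lemma exists_finset_hull_eq {τ : PointedCone ℝ (RealSpace N)} (h : τ.IsFaceOf σ.cone) :
    ∃ s : Finset (RealSpace N), PointedCone.hull ℝ (s : Set (RealSpace N)) = τ := by
  obtain ⟨s, hs⟩ := σ.rational
  have hfin := ((s.finite_toSet.image fun a : N => (1 : ℝ) ⊗ₜ[ℤ] a).inter_of_left
    (τ : Set (RealSpace N)))
  refine ⟨hfin.toFinset, ?_⟩
  rw [hfin.coe_toFinset]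
  exact hull_inter_eq (by rw [← hs]; exact h)

/-- The ray spanned by a vector, as a one-dimensional face. -/
def rayFace {a : RealSpace N} (ha : a ≠ 0) (h : (PointedCone.hull ℝ {a}).IsFaceOf σ.cone) :
    σ.Face 1 :=
  ⟨PointedCone.hull ℝ {a}, h, finrank_span_hull_singleton ha⟩

lemma exists_generator (τ : σ.Face 1) :
    ∃ a : RealSpace N, a ≠ 0 ∧ τ.1 = PointedCone.hull ℝ {a} := by
  have hsal := salient_of_isFaceOf τ.2.1
  obtain ⟨a, ha, ha0⟩ : ∃ a ∈ τ.1, a ≠ 0 := by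
    by_contra! hcon
    have h2 := τ.2.2
    rw [Submodule.span_eq_bot.2 hcon, finrank_bot] at h2
    omega
  refine ⟨a, ha0, le_antisymm (fun x hx => ?_)
    (Submodule.span_le.2 (Set.singleton_subset_iff.2 ha))⟩
  obtain ⟨t, ht⟩ := (finrank_eq_one_iff_of_nonzero' (⟨a, Submodule.subset_span ha⟩ : τ.span)
    (by simpa using ha0)).1 τ.2.2 ⟨x, Submodule.subset_span hx⟩
  have ht' : t • a = x := congrArg Subtype.val ht
  subst ht'
  rcases le_or_gt 0 t with h | h
  · exact mem_hull_singleton.2 ⟨t, h, rfl⟩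
  · rw [eq_zero_of_add_eq_zero hsal hx (PointedCone.smul_mem _ (neg_nonneg.2 h.le) ha)
      (by rw [neg_smul, add_neg_cancel])]
    exact Submodule.zero_mem _

variable (σ) in
/-- The zero-dimensional face. -/
def apex : σ.Face 0 :=
  ⟨⊥, ⟨bot_le, fun {x y c} hx hy hc h => by
    have h' : c • x + y = 0 := h
    have := eq_zero_of_add_eq_zero σ.salient (PointedCone.smul_mem _ hc.le hx) hy h'
    exact (smul_eq_zero.1 this).resolve_left hc.ne'⟩, by
    rw [show Submodule.span ℝ ((⊥ : PointedCone ℝ (RealSpace N)) : Set (RealSpace N)) = ⊥ from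
      Submodule.span_eq_bot.2 fun x hx => hx, finrank_bot]⟩

/-- The empty basis contained in `o` makes the span trivial; `finrank` equal to `0` alone would also
require the span to be finite-dimensional. -/
lemma eq_apex (o : σ.Orientations) (τ : σ.Face 0) : τ = apex σ := by
  have : Subsingleton τ.span := (o 0 τ).repr.toEquiv.subsingleton
  refine Subtype.ext (le_antisymm (fun x hx => ?_) bot_le)
  exact congrArg Subtype.val
    (Subsingleton.elim (⟨x, Submodule.subset_span hx⟩ : τ.span) 0)

lemma K_apex (R : Module.Dual ℤ N) : K R (apex σ) = σ.latticePoints :=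
  Set.ext fun _ => ⟨fun h => h.1, fun h => ⟨h, fun _ hx hx0 => absurd hx hx0⟩⟩

/-- A functional nonnegative on the extreme generators is nonnegative on the whole cone. Applied to
`r - R`, this shows that the sets `K_τ^R` of the rays cover `Λ ∖ Λ(R)`. -/
lemma exists_ray_pairing_neg {r : Module.Dual ℤ N} (hr : r ∉ σ.latticePoints) :
    ∃ τ : σ.Face 1, ∀ x ∈ τ.1, x ≠ 0 → pairing r x < 0 := by
  obtain ⟨s, hs⟩ := exists_finset_hull_eq (PointedCone.IsFaceOf.refl σ.cone)
  obtain ⟨t, hts, ht⟩ := exists_extreme_generators s (by rw [hs]; exact σ.salient)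
  rw [hs] at hts ht
  by_contra! hcon
  refine hr fun x hx => ?_
  rw [← hts] at hx
  induction hx using Submodule.span_induction with
  | mem a ha =>
    obtain ⟨x, hx, hx0, hx'⟩ := hcon (rayFace (ht a ha).1 (ht a ha).2)
    obtain ⟨c, hc, rfl⟩ := mem_hull_singleton.1 hx
    rw [map_smul, smul_eq_mul] at hx'
    have hc' : 0 < c := hc.lt_of_ne fun h => hx0 (by rw [← h, zero_smul])
    exact nonneg_of_mul_nonneg_right hx' hc'
  | zero => simp
  | add x y _ _ hx hy => rw [map_add]; exact add_nonneg hx hy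
  | smul c x _ hx =>
    change 0 ≤ pairing r (c.1 • x)
    rw [map_smul]
    exact mul_nonneg c.2 hx

lemma exists_smul_eq_basis (o : σ.Orientations) (τ : σ.Face 1) {a : RealSpace N} (ha : a ≠ 0)
    (hτ : τ.1 = PointedCone.hull ℝ {a}) :
    ∃ c : ℝ, c ≠ 0 ∧ ((o 1 τ 0 : τ.span) : RealSpace N) = c • a := by
  have haτ : a ∈ τ.span := Submodule.subset_span (by rw [hτ]; exact Submodule.subset_span rfl)
  obtain ⟨c, hc⟩ := (finrank_eq_one_iff_of_nonzero' (⟨a, haτ⟩ : τ.span)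
    (by simpa using ha)).1 τ.2.2 (o 1 τ 0)
  refine ⟨c, ?_, (congrArg Subtype.val hc).symm⟩
  rintro rfl
  exact (o 1 τ).ne_zero 0 (by rw [← hc, zero_smul])

lemma incidence_apex (o : σ.Orientations) (τ : σ.Face 1) {a : RealSpace N} (ha : a ≠ 0)
    (hτ : τ.1 = PointedCone.hull ℝ {a}) {c : ℝ} (hc : c ≠ 0)
    (hb : ((o 1 τ 0 : τ.span) : RealSpace N) = c • a) :
    incidence o (apex σ) τ = if 0 < c then 1 else -1 := by
  classical
  have hspan : (apex σ).span ≤ τ.span :=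
    Submodule.span_mono fun x hx => hx ▸ Submodule.zero_mem _
  unfold incidence
  rw [dif_pos ⟨hspan, bot_le⟩]
  refine if_congr ?_ rfl rfl
  -- Relative to the basis vector `c • a`, the vector `t • a` has coordinate `t / c`. As `t ≥ 0` on
  -- the ray, the sign is that of `c`.
  have hval : ∀ v : τ.span, ∀ t : ℝ, t • a = v → (o 1 τ).det
      (Fin.snoc (fun j => Submodule.inclusion hspan (o 0 (apex σ) j)) v) * c = t := by
    intro v t ht
    have := congrArg Subtype.val ((o 1 τ).sum_repr v)
    rw [Fin.sum_univ_one, Submodule.coe_smul, hb, ← ht, smul_smul] at this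
    rw [Module.Basis.det_apply, Matrix.det_fin_one, Module.Basis.toMatrix_apply]
    exact smul_left_injective ℝ ha this
  constructor
  · rintro ⟨v, hv, hpos⟩
    rw [hτ] at hv
    obtain ⟨t, ht, htv⟩ := mem_hull_singleton.1 hv
    have key := hval v t htv
    by_contra! hneg
    have := mul_neg_of_pos_of_neg hpos (hneg.lt_of_ne hc)
    exact absurd (key ▸ this) (not_lt.2 ht)
  · intro hpos
    have haτ : a ∈ τ.1 := by rw [hτ]; exact Submodule.subset_span rfl
    have key := hval ⟨a, Submodule.subset_span haτ⟩ 1 (one_smul ℝ a)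
    refine ⟨⟨a, Submodule.subset_span haτ⟩, haτ, ?_⟩
    exact pos_of_mul_pos_left (key.symm ▸ one_pos) hpos.le

/-- Linear functionals on the ambient space which extend the coordinates in the chosen basis of
a two-dimensional face. -/
lemma exists_coordinates (o : σ.Orientations) (τ' : σ.Face 2) :
    ∃ f₀ f₁ : RealSpace N →ₗ[ℝ] ℝ,
      (∀ x ∈ τ'.span, f₀ x = 0 → f₁ x = 0 → x = 0) ∧
      ∀ w : Fin 2 → τ'.span, (o 2 τ').det w = planeDet f₀ f₁ (w 0) (w 1) := by
  obtain ⟨f₀, h₀⟩ := LinearMap.exists_extend ((o 2 τ').coord 0)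
  obtain ⟨f₁, h₁⟩ := LinearMap.exists_extend ((o 2 τ').coord 1)
  have e₀ : ∀ x : τ'.span, f₀ x = (o 2 τ').repr x 0 := fun x => LinearMap.congr_fun h₀ x
  have e₁ : ∀ x : τ'.span, f₁ x = (o 2 τ').repr x 1 := fun x => LinearMap.congr_fun h₁ x
  refine ⟨f₀, f₁, fun x hx hx0 hx1 => ?_, fun w => ?_⟩
  · have hz : (⟨x, hx⟩ : τ'.span) = 0 := by
      refine (o 2 τ').ext_elem fun j => ?_
      rw [map_zero, Finsupp.zero_apply]
      revert j
      rw [Fin.forall_fin_two]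
      exact ⟨by rw [← e₀]; exact hx0, by rw [← e₁]; exact hx1⟩
    exact congrArg Subtype.val hz
  · rw [Module.Basis.det_apply, Matrix.det_fin_two]
    simp only [Module.Basis.toMatrix_apply, planeDet, e₀, e₁]
    ring

lemma incidence_of_le (o : σ.Orientations) {τ : σ.Face 1} {τ' : σ.Face 2} (hle : τ.1 ≤ τ'.1)
    {f₀ f₁ : RealSpace N →ₗ[ℝ] ℝ}
    (hdet : ∀ w : Fin 2 → τ'.span, (o 2 τ').det w = planeDet f₀ f₁ (w 0) (w 1))
    {a : RealSpace N} {c : ℝ} (hb : ((o 1 τ 0 : τ.span) : RealSpace N) = c • a) :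
    incidence o τ τ' =
      open Classical in if ∃ v ∈ τ'.1, 0 < c * planeDet f₀ f₁ a v then 1 else -1 := by
  classical
  unfold incidence
  have hspan : τ.span ≤ τ'.span := Submodule.span_mono hle
  rw [dif_pos ⟨hspan, hle⟩]
  have hval : ∀ v : τ'.span, (o 2 τ').det
      (Fin.snoc (fun j => Submodule.inclusion hspan (o 1 τ j)) v) =
        c * planeDet f₀ f₁ a v := by
    intro v
    rw [hdet]
    change planeDet f₀ f₁ ((o 1 τ 0 : τ.span) : RealSpace N) v = _
    rw [hb]
    unfold planeDet
    simp only [map_smul, smul_eq_mul]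
    ring
  refine if_congr ?_ rfl rfl
  constructor
  · rintro ⟨v, hv, hpos⟩
    exact ⟨v, hv, (hval v) ▸ hpos⟩
  · rintro ⟨v, hv, hpos⟩
    exact ⟨⟨v, Submodule.subset_span hv⟩, hv, by rw [hval]; exact hpos⟩

lemma exists_planeDet_ne_zero {τ' : σ.Face 2} {f₀ f₁ : RealSpace N →ₗ[ℝ] ℝ}
    (hf : ∀ x ∈ τ'.span, f₀ x = 0 → f₁ x = 0 → x = 0) {a : RealSpace N} (ha : a ≠ 0)
    (haτ : a ∈ τ'.1) : ∃ v ∈ τ'.1, planeDet f₀ f₁ a v ≠ 0 := by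
  by_contra! hcon
  have hle : τ'.1 = PointedCone.hull ℝ {a} := le_antisymm
    (fun v hv => mem_hull_of_planeDet_eq_zero hf (salient_of_isFaceOf τ'.2.1) haτ hv ha
      (hcon v hv)) (Submodule.span_le.2 (Set.singleton_subset_iff.2 haτ))
  have h2 := τ'.2.2
  rw [hle, finrank_span_hull_singleton ha] at h2
  omega

/-- The two boundary rays of a two-dimensional face occur with opposite signs. -/
lemma incidence_mul_incidence_apex (o : σ.Orientations) {τ : σ.Face 1} {τ' : σ.Face 2}
    (hle : τ.1 ≤ τ'.1) {f₀ f₁ : RealSpace N →ₗ[ℝ] ℝ}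
    (hf : ∀ x ∈ τ'.span, f₀ x = 0 → f₁ x = 0 → x = 0)
    (hdet : ∀ w : Fin 2 → τ'.span, (o 2 τ').det w = planeDet f₀ f₁ (w 0) (w 1))
    {a : RealSpace N} (ha : a ≠ 0) (hτ : τ.1 = PointedCone.hull ℝ {a}) :
    ((∀ v ∈ τ'.1, 0 ≤ planeDet f₀ f₁ a v) →
      incidence o τ τ' * incidence o (apex σ) τ = 1) ∧
    ((∀ v ∈ τ'.1, planeDet f₀ f₁ a v ≤ 0) →
      incidence o τ τ' * incidence o (apex σ) τ = -1) := by
  obtain ⟨c, hc, hb⟩ := exists_smul_eq_basis o τ ha hτ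
  obtain ⟨v, hv, hv0⟩ := exists_planeDet_ne_zero hf ha
    (hle (by rw [hτ]; exact Submodule.subset_span rfl))
  rw [incidence_of_le o hle hdet hb, incidence_apex o τ ha hτ hc hb]
  -- Both incidence numbers change sign with `c`, so the product depends only on the side of the ray
  -- on which the face lies.
  rcases hc.lt_or_gt with hneg | hpos
  · rw [if_neg hneg.not_gt]
    refine ⟨fun h => ?_, fun h => ?_⟩
    · rw [if_neg]
      · rfl
      · rintro ⟨w, hw, hw'⟩
        exact absurd hw' (not_lt.2 (mul_nonpos_of_nonpos_of_nonneg hneg.le (h w hw)))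
    · rw [if_pos ⟨v, hv, mul_pos_of_neg_of_neg hneg ((h v hv).lt_of_ne hv0)⟩]
      rfl
  · rw [if_pos hpos]
    refine ⟨fun h => ?_, fun h => ?_⟩
    · rw [if_pos ⟨v, hv, mul_pos hpos ((h v hv).lt_of_ne' hv0)⟩]
      rfl
    · rw [if_neg]
      · rfl
      · rintro ⟨w, hw, hw'⟩
        exact absurd hw' (not_lt.2 (mul_nonpos_of_nonneg_of_nonpos hpos.le (h w hw)))

/-- The square of the boundary map of the face complex vanishes on two-dimensional faces. -/
lemma sum_incidence_mul_incidence_apex (o : σ.Orientations) (τ' : σ.Face 2) :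
    ∑ᶠ τ : σ.Face 1, incidence o τ τ' * incidence o (apex σ) τ = 0 := by
  classical
  obtain ⟨f₀, f₁, hf, hdet⟩ := exists_coordinates o τ'
  have hsal := salient_of_isFaceOf τ'.2.1
  obtain ⟨s, hs⟩ := exists_finset_hull_eq τ'.2.1
  obtain ⟨b, hb, hbface, hbneg⟩ := exists_ray_planeDet_nonpos hf hsal hs τ'.2.2
  -- Exchanging the coordinates reverses the sign of the determinant, which gives the ray with the
  -- face on its nonnegative side.
  obtain ⟨a, ha, haface, hapos'⟩ := exists_ray_planeDet_nonpos
    (fun x hx h1 h0 => hf x hx h0 h1) hsal hs τ'.2.2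
  have hapos : ∀ v ∈ τ'.1, 0 ≤ planeDet f₀ f₁ a v := fun v hv => by
    have := hapos' v hv
    rw [planeDet_swap] at this
    linarith
  have hA := (incidence_mul_incidence_apex o (τ := rayFace ha (haface.trans τ'.2.1))
    haface.le hf hdet ha rfl).1 hapos
  have hB := (incidence_mul_incidence_apex o (τ := rayFace hb (hbface.trans τ'.2.1))
    hbface.le hf hdet hb rfl).2 hbneg
  have : Fintype (σ.Face 1) := Fintype.ofFinite _
  rw [finsum_eq_sum_of_fintype, Finset.sum_eq_add
    (rayFace ha (haface.trans τ'.2.1)) (rayFace hb (hbface.trans τ'.2.1)), hA, hB]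
  · rfl
  · intro h
    rw [h, hB] at hA
    exact absurd hA (by decide)
  -- Any ray of the face has the face on one side, hence coincides with the ray of `a` or of `b`;
  -- all other rays have incidence zero.
  · rintro τ - ⟨hτa, hτb⟩
    by_cases hle : τ.1 ≤ τ'.1
    · exfalso
      obtain ⟨c, hc, hτ⟩ := exists_generator τ
      have hcface : (PointedCone.hull ℝ {c}).IsFaceOf τ'.1 := by
        rw [← hτ]
        exact (PointedCone.IsFaceOf.isFaceOf_iff_le τ.2.1 τ'.2.1).2 hle
      have hmem : ∀ {x : RealSpace N}, (PointedCone.hull ℝ {x}).IsFaceOf τ'.1 → x ∈ τ'.1 :=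
        fun h => h.le (Submodule.subset_span rfl)
      rcases planeDet_nonneg_or_nonpos hf hsal hc hcface with h | h
      · refine hτa (Subtype.ext (hτ.trans (le_antisymm ?_ ?_)))
        · exact hull_le_of_planeDet_nonneg hf hsal (hmem haface) (hmem hcface) ha hapos h
        · exact hull_le_of_planeDet_nonneg hf hsal (hmem hcface) (hmem haface) hc h hapos
      · have hf' := fun x hx h1 h0 => hf x hx h0 h1
        have hc' : ∀ v ∈ τ'.1, 0 ≤ planeDet f₁ f₀ c v := fun v hv => by
          rw [planeDet_swap]; linarith [h v hv]
        have hb' : ∀ v ∈ τ'.1, 0 ≤ planeDet f₁ f₀ b v := fun v hv => by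
          rw [planeDet_swap]; linarith [hbneg v hv]
        refine hτb (Subtype.ext (hτ.trans (le_antisymm ?_ ?_)))
        · exact hull_le_of_planeDet_nonneg hf' hsal (hmem hbface) (hmem hcface) hb hb' hc'
        · exact hull_le_of_planeDet_nonneg hf' hsal (hmem hcface) (hmem hbface) hc hc' hb'
    · have : incidence o τ τ' = 0 := by
        unfold incidence
        rw [dif_neg fun h => hle h.2]
      rw [this, zero_mul]
  · exact fun h => absurd (Finset.mem_univ _) h
  · exact fun h => absurd (Finset.mem_univ _) h

end RationalCone

/-! ### The total complex on vertex cochains, and injectivity of the canonical map -/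

section DoubleComplexLemmas

open RationalCone

variable {N : Type*} [AddCommGroup N] {k : Type*} [Field k] {σ : RationalCone N}
  {R : Module.Dual ℤ N}

lemma tuples_mono {M : Type*} [AddCommGroup M] {P P' : Set M} (h : P ⊆ P') (n : ℕ) :
    tuples P n ⊆ tuples P' n :=
  fun _ hv => ⟨fun j => h (hv.1 j), h hv.2⟩

lemma res_res {M : Type*} [AddCommGroup M] {P P' P'' : Set M} (h : P'' ⊆ P') {n : ℕ}
    (φ : Cochain k P n) : res P'' (res P' φ) = res P'' φ := by
  funext v
  exact ev_res φ (tuples_mono h n v.2)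

lemma K_anti {p q : ℕ} {τ : σ.Face p} {τ' : σ.Face q} (h : τ.1 ≤ τ'.1) : K R τ' ⊆ K R τ :=
  fun _ hr => ⟨hr.1, fun x hx => hr.2 x (h hx)⟩

lemma K_subset {p : ℕ} (τ : σ.Face p) : K R τ ⊆ σ.latticePoints := fun _ hr => hr.1

lemma horizontal_onVertex_apply (o : σ.Orientations) {n : ℕ} (φ : Cochain k σ.latticePoints n)
    (τ' : σ.Face 1) :
    horizontal o 0 n (onVertex R n φ) τ' =
      incidence o (apex σ) τ' • res (K R τ') φ := by
  change ∑ᶠ τ : σ.Face 0, incidence o τ τ' • res (K R τ') (res (K R τ) φ) = _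
  rw [finsum_eq_single _ (apex σ) fun τ hτ => absurd (eq_apex o τ) hτ,
    res_res (by rw [K_apex]; exact K_subset τ')]

lemma horizontal_horizontal_onVertex (o : σ.Orientations) {n : ℕ}
    (φ : Cochain k σ.latticePoints n) :
    horizontal o 1 n (horizontal o 0 n (onVertex R n φ)) = 0 := by
  funext τ'
  change ∑ᶠ τ : σ.Face 1, incidence o τ τ' •
    res (K R τ') (horizontal o 0 n (onVertex R n φ) τ) = 0
  have h : ∀ τ : σ.Face 1, incidence o τ τ' •
      res (K R τ') (horizontal o 0 n (onVertex R n φ) τ) =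
        (incidence o τ τ' * incidence o (apex σ) τ) • res (K R τ') φ := by
    intro τ
    rw [horizontal_onVertex_apply, map_zsmul, smul_smul]
    by_cases hle : τ.1 ≤ τ'.1
    · rw [res_res (K_anti hle)]
    · have : incidence o τ τ' = 0 := by
        unfold incidence
        rw [dif_neg fun h => hle h.2]
      rw [this, zero_mul, zero_smul, zero_smul]
  rw [finsum_congr h]
  -- All terms are integer multiples of one restriction, so the integer coefficients can be summed
  -- first.
  refine ((zmultiplesHom _ (res (K R τ') φ)).map_finsum (Set.toFinite _)).symm.trans ?_
  rw [sum_incidence_mul_incidence_apex o τ', map_zero]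

lemma vertical_horizontal_onVertex (o : σ.Orientations) {n : ℕ}
    (φ : Cochain k σ.latticePoints n) :
    vertical 1 n (horizontal o 0 n (onVertex R n φ)) =
      horizontal o 0 (n + 1) (onVertex R (n + 1) (diff n φ)) := by
  funext τ'
  change diff n (horizontal o 0 n (onVertex R n φ) τ') = _
  rw [horizontal_onVertex_apply, horizontal_onVertex_apply, map_zsmul, res_diff]

lemma vertical_onVertex {n : ℕ} (φ : Cochain k σ.latticePoints n) :
    vertical 0 n (onVertex R n φ) = onVertex R (n + 1) (diff n φ) := by
  funext τ
  exact (res_diff τ φ).symm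

lemma inBidegree_same (p q : ℕ) (x : DoubleComplex k σ R p q) : inBidegree p q x p q = x := by
  simp [inBidegree]

lemma inBidegree_ne {p q p' q' : ℕ} (x : DoubleComplex k σ R p q) (h : p' ≠ p ∨ q' ≠ q) :
    inBidegree p q x p' q' = 0 := by
  by_cases hp : p' = p
  · subst hp
    simp [inBidegree, h.resolve_left (by simp)]
  · simp [inBidegree, hp]

lemma totalDiff_inBidegree (o : σ.Orientations) (p q : ℕ) (x : DoubleComplex k σ R p q) :
    totalDiff o (inBidegree p q x) = inBidegree (p + 1) q (horizontal o p q x) +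
      (-1 : k) ^ p • inBidegree p (q + 1) (vertical p q x) := by
  have hhor : ∀ p' q', (match (motive := ∀ p', DoubleComplex k σ R p' q') p' with
      | 0 => 0
      | p' + 1 => horizontal o p' q' (inBidegree p q x p' q')) =
      inBidegree (p + 1) q (horizontal o p q x) p' q' := by
    intro p' q'
    rcases p' with _ | p'
    · rw [inBidegree_ne _ (Or.inl (by omega))]
    · by_cases h : p' = p ∧ q' = q
      · obtain ⟨rfl, rfl⟩ := h
        rw [inBidegree_same]
        simp only [inBidegree_same]
      · have h' : p' ≠ p ∨ q' ≠ q := by omega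
        rw [inBidegree_ne _ (h'.imp_left fun h => by omega)]
        simp only [inBidegree_ne x h', map_zero]
  have hver : ∀ p' q', (match (motive := ∀ q', DoubleComplex k σ R p' q') q' with
      | 0 => 0
      | q' + 1 => vertical p' q' (inBidegree p q x p' q')) =
      inBidegree p (q + 1) (vertical p q x) p' q' := by
    intro p' q'
    rcases q' with _ | q'
    · rw [inBidegree_ne _ (Or.inr (by omega))]
    · by_cases h : p' = p ∧ q' = q
      · obtain ⟨rfl, rfl⟩ := h
        rw [inBidegree_same]
        simp only [inBidegree_same]
      · have h' : p' ≠ p ∨ q' ≠ q := by omega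
        rw [inBidegree_ne _ (h'.imp_right fun h => by omega)]
        simp only [inBidegree_ne x h', map_zero]
  funext p' q'
  refine (congrArg₂ (· + ·) (hhor p' q')
    (congrArg ((-1 : k) ^ p' • ·) (hver p' q'))).trans ?_
  change _ = inBidegree (p + 1) q (horizontal o p q x) p' q' +
    (-1 : k) ^ p • inBidegree p (q + 1) (vertical p q x) p' q'
  -- The definition carries the sign of the evaluated column `p'`, the statement that of `p`; they
  -- can differ only where the component is zero.
  by_cases h : p' = p
  · rw [h]
  · rw [inBidegree_ne (vertical p q x) (Or.inl h), smul_zero, smul_zero]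

/-- The total differential of a cochain on `Λ`. -/
lemma totalDiff_inBidegree_onVertex (o : σ.Orientations) {n : ℕ}
    (φ : Cochain k σ.latticePoints n) :
    totalDiff o (inBidegree 0 n (onVertex R n φ)) =
      inBidegree 1 n (horizontal o 0 n (onVertex R n φ)) +
        inBidegree 0 (n + 1) (onVertex R (n + 1) (diff n φ)) := by
  rw [totalDiff_inBidegree, pow_zero, one_smul, vertical_onVertex]

/-- The terms `δδφ` and `ddφ` vanish, while `δdφ` and `dδφ` cancel because `d` enters with sign `-1`
in column `1`. -/
lemma totalDiff_totalDiff_onVertex (o : σ.Orientations) {n : ℕ}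
    (φ : Cochain k σ.latticePoints n) (hφ : diff (n + 1) (diff n φ) = 0) :
    totalDiff o (totalDiff o (inBidegree 0 n (onVertex R n φ))) = 0 := by
  rw [totalDiff_inBidegree_onVertex, map_add, totalDiff_inBidegree_onVertex,
    totalDiff_inBidegree, horizontal_horizontal_onVertex, vertical_horizontal_onVertex, hφ]
  simp

lemma horizontal_mem_hodge (o : σ.Orientations) {i n : ℕ} {φ : Cochain k σ.latticePoints n}
    (hφ : φ ∈ hodge k i n σ.latticePoints ∅) (τ : σ.Face 1) :
    horizontal o 0 n (onVertex R n φ) τ ∈ hodge k i n (K R τ) ∅ := by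
  rw [horizontal_onVertex_apply]
  exact zsmul_mem (res_hodge τ hφ) _

lemma inBidegree_mem_total {i p q : ℕ} {x : DoubleComplex k σ R p q}
    (hx : ∀ τ, x τ ∈ hodge k i q (K R τ) ∅) :
    inBidegree p q x ∈ total k σ R i (p + q) := by
  refine ⟨fun p' q' h => inBidegree_ne x (by omega), fun p' q' τ => ?_⟩
  by_cases h : p' = p ∧ q' = q
  · obtain ⟨rfl, rfl⟩ := h
    rw [inBidegree_same]
    exact hx τ
  · rw [inBidegree_ne x (by omega)]
    exact Submodule.zero_mem _

/-- A cochain of `Λ` whose restrictions to the sets `K_τ^R` of the rays vanish is a relative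
cochain. -/
lemma mem_hodge_of_horizontal_eq_zero (o : σ.Orientations) {i n : ℕ}
    {φ : Cochain k σ.latticePoints n} (hφ : φ ∈ hodge k i n σ.latticePoints ∅)
    (h : horizontal o 0 n (onVertex R n φ) = 0) :
    φ ∈ hodge k i n σ.latticePoints (σ.latticePoints \ σ.shifted R) := by
  refine ⟨hφ.1, hφ.2.1, fun v hv => ?_⟩
  -- The sum of the tuple lies outside `Λ(R)`, so some ray `τ` has it in `K_τ^R`. That set is closed
  -- under passing to summands in `Λ`, so the whole tuple lies in it.
  obtain ⟨τ, hτ⟩ := exists_ray_pairing_neg (σ := σ) hv.2.2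
  have hsum : ∑ j, v.1 j ∈ K R τ := ⟨v.2.2, fun x hx hx0 => by
    have := hτ x hx hx0
    rw [pairing_sub] at this ⊢
    linarith⟩
  have hvK : v.1 ∈ tuples (K R τ) n := by
    refine ⟨fun j => K_of_le (v.2.1 j) hsum fun x hx => ?_, hsum⟩
    rw [pairing_sub, pairing_sum, sub_nonneg]
    exact Finset.single_le_sum (f := fun j => pairing (v.1 j) x)
      (fun j _ => v.2.1 j x hx) (Finset.mem_univ j)
  have h1 := congrFun h τ
  rw [horizontal_onVertex_apply] at h1
  have h2 : res (K R τ) φ = 0 := by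
    have hε : incidence o (apex σ) τ = 1 ∨ incidence o (apex σ) τ = -1 := by
      obtain ⟨a, ha, haτ⟩ := exists_generator τ
      obtain ⟨c, hc, hb⟩ := exists_smul_eq_basis o τ ha haτ
      rw [incidence_apex o τ ha haτ hc hb]
      split_ifs <;> simp
    rcases hε with hε | hε <;> simpa [hε] using h1
  have h3 : ev φ v.1 = 0 := congrFun h2 ⟨v.1, hvK⟩
  rwa [ev_of_mem φ v.2] at h3

/-- The sets `K R (apex σ)` and `σ.latticePoints` are equal but not definitionally so; cochains on
them are identified through `res`. -/
lemma res_bijective_of_eq {M : Type*} [AddCommGroup M] {P P' : Set M} (h : P = P') (n : ℕ) :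
    Function.Bijective (res (k := k) (P := P) P' (n := n)) := by
  subst h
  have : (res (k := k) (P := P) P (n := n)) = LinearMap.id := by
    ext φ v
    exact ev_of_mem φ v.2
  rw [this]
  exact Function.bijective_id

lemma onVertex_bijective (o : σ.Orientations) (n : ℕ) :
    Function.Bijective (onVertex (k := k) (σ := σ) R n) := by
  have hb := res_bijective_of_eq (k := k) (K_apex (σ := σ) R).symm n
  refine ⟨fun φ ψ h => hb.1 (congrFun h (apex σ)), fun x => ?_⟩
  obtain ⟨φ, hφ⟩ := hb.2 (x (apex σ))
  refine ⟨φ, funext fun τ => ?_⟩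
  rw [eq_apex o τ]
  exact hφ

lemma hodge_of_res {M : Type*} [AddCommGroup M] {P P' : Set M} (h : P = P') {i n : ℕ}
    {φ : Cochain k P n} (hφ : res P' φ ∈ hodge k i n P' ∅) : φ ∈ hodge k i n P ∅ := by
  subst h
  have : res P φ = φ := by
    funext v
    exact ev_of_mem φ v.2
  rwa [this] at hφ

/-- The terms of lowest degree of the total complex come from cochains of `Λ`. -/
lemma exists_of_mem_total (o : σ.Orientations) {n : ℕ} {y : BigradedSpace k σ R}
    (hy : y ∈ total k σ R n n) :
    ∃ φ ∈ hodge k n n σ.latticePoints ∅, y = inBidegree 0 n (onVertex R n φ) := by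
  obtain ⟨φ, hφ⟩ := (onVertex_bijective o n).2 (y 0 n)
  refine ⟨φ, hodge_of_res (K_apex (σ := σ) R).symm ?_, ?_⟩
  · have := hy.2 0 n (apex σ)
    rw [← hφ] at this
    exact this
  · funext p q
    by_cases hpq : p + q = n
    · rcases p with _ | p
      · obtain rfl : q = n := by omega
        rw [inBidegree_same, hφ]
      · rw [inBidegree_ne _ (Or.inl (by omega))]
        -- Here `q < n`, where the Hodge piece of index `n` is zero.
        funext τ
        exact (hy.2 (p + 1) q τ).1 (by omega)
    · rw [hy.1 p q hpq, inBidegree_ne _ (by omega)]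

/-- A primitive of `φ` in the total complex is a vertex cochain `ψ`. Its component in bidegree `(1,
n)` gives `δψ = 0`, so `ψ` is relative; the one in bidegree `(0, n + 1)` gives `dψ = φ`. -/
theorem toTotal_injective (o : σ.Orientations) (n : ℕ) :
    Function.Injective (toTotal k R o n n) := by
  rw [injective_iff_map_eq_zero]
  intro c hc
  obtain ⟨⟨φ, hφ⟩, rfl⟩ := Submodule.Quotient.mk_surjective _ c
  have hc' : (Submodule.Quotient.mk (cocyclesToTotal o n (n + 1) ⟨φ, hφ⟩) :
      TotalCohomology k R o n n) = 0 := hc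
  rw [Submodule.Quotient.mk_eq_zero] at hc' ⊢
  obtain ⟨y, hy, hyφ⟩ := hc'
  obtain ⟨ψ, hψ, rfl⟩ := exists_of_mem_total o hy
  have hyφ' : totalDiff o (inBidegree 0 n (onVertex R n ψ)) =
    inBidegree 0 (n + 1) (onVertex R (n + 1) φ) := hyφ
  rw [totalDiff_inBidegree_onVertex] at hyφ'
  have h1 := congrFun (congrFun hyφ' 1) n
  have h0 := congrFun (congrFun hyφ' 0) (n + 1)
  simp only [Pi.add_apply] at h0 h1
  rw [inBidegree_same, inBidegree_ne _ (Or.inl (by omega)),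
    inBidegree_ne _ (Or.inl (by omega)), add_zero] at h1
  rw [inBidegree_same, inBidegree_same, inBidegree_ne _ (Or.inl (by omega)), zero_add] at h0
  exact ⟨ψ, mem_hodge_of_horizontal_eq_zero o hψ h1, (onVertex_bijective o (n + 1)).1 h0⟩

end DoubleComplexLemmas

/-! ### Explicit differentials, shuffles and Hodge pieces in low degree -/

section LowDegree

variable {M : Type*} [AddCommGroup M] {k : Type*} [Field k] {P : Set M}

lemma diff_one_apply (φ : Cochain k P 1) (v : tuples P 2) :
    diff 1 φ v = ev φ ![v.1 1] - ev φ ![v.1 0 + v.1 1] + ev φ ![v.1 0] := by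
  have h0 : (fun j : Fin 1 => v.1 j.succ) = ![v.1 1] := by
    funext j; fin_cases j; rfl
  have h1 : Fin.contractNth 0 (· + ·) v.1 = ![v.1 0 + v.1 1] := by
    funext j; fin_cases j; rfl
  have h2 : Fin.contractNth 1 (· + ·) v.1 = ![v.1 0] := by
    funext j; fin_cases j; rfl
  change ev φ _ + ∑ j : Fin 2, _ = _
  rw [Fin.sum_univ_two, h0, h1, h2]
  simp
  ring

lemma diff_two_apply (φ : Cochain k P 2) (v : tuples P 3) :
    diff 2 φ v = ev φ ![v.1 1, v.1 2] - ev φ ![v.1 0 + v.1 1, v.1 2]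
      + ev φ ![v.1 0, v.1 1 + v.1 2] - ev φ ![v.1 0, v.1 1] := by
  have h0 : (fun j : Fin 2 => v.1 j.succ) = ![v.1 1, v.1 2] := by
    funext j; fin_cases j <;> rfl
  have h1 : Fin.contractNth 0 (· + ·) v.1 = ![v.1 0 + v.1 1, v.1 2] := by
    funext j; fin_cases j <;> rfl
  have h2 : Fin.contractNth 1 (· + ·) v.1 = ![v.1 0, v.1 1 + v.1 2] := by
    funext j; fin_cases j <;> rfl
  have h3 : Fin.contractNth 2 (· + ·) v.1 = ![v.1 0, v.1 1] := by
    funext j; fin_cases j <;> rfl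
  change ev φ _ + ∑ j : Fin 3, _ = _
  rw [Fin.sum_univ_three, h0, h1, h2, h3]
  simp
  ring

lemma diff_three_apply (φ : Cochain k P 3) (v : tuples P 4) :
    diff 3 φ v = ev φ ![v.1 1, v.1 2, v.1 3] - ev φ ![v.1 0 + v.1 1, v.1 2, v.1 3]
      + ev φ ![v.1 0, v.1 1 + v.1 2, v.1 3] - ev φ ![v.1 0, v.1 1, v.1 2 + v.1 3]
      + ev φ ![v.1 0, v.1 1, v.1 2] := by
  have h0 : (fun j : Fin 3 => v.1 j.succ) = ![v.1 1, v.1 2, v.1 3] := by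
    funext j; fin_cases j <;> rfl
  have h1 : Fin.contractNth 0 (· + ·) v.1 = ![v.1 0 + v.1 1, v.1 2, v.1 3] := by
    funext j; fin_cases j <;> rfl
  have h2 : Fin.contractNth 1 (· + ·) v.1 = ![v.1 0, v.1 1 + v.1 2, v.1 3] := by
    funext j; fin_cases j <;> rfl
  have h3 : Fin.contractNth 2 (· + ·) v.1 = ![v.1 0, v.1 1, v.1 2 + v.1 3] := by
    funext j; fin_cases j <;> rfl
  have h4 : Fin.contractNth 3 (· + ·) v.1 = ![v.1 0, v.1 1, v.1 2] := by
    funext j; fin_cases j <;> rfl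
  change ev φ _ + ∑ j : Fin 4, _ = _
  rw [Fin.sum_univ_four, h0, h1, h2, h3, h4]
  simp
  ring

lemma shuffle_two_apply (φ : Cochain k P 2) (v : Fin 2 → M) :
    shuffle φ v = ev φ ![v 0, v 1] - ev φ ![v 1, v 0] := by
  classical
  have huniv : (Finset.univ : Finset (Equiv.Perm (Fin 2))) = {1, Equiv.swap 0 1} := by decide
  have hs1 : IsShuffle 1 (1 : Equiv.Perm (Fin 2)) := by unfold IsShuffle; decide
  have hs2 : IsShuffle 1 (Equiv.swap 0 1 : Equiv.Perm (Fin 2)) := by unfold IsShuffle; decide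
  have e1 : (fun j : Fin 2 => v ((1 : Equiv.Perm (Fin 2))⁻¹ j)) = ![v 0, v 1] := by
    funext j; fin_cases j <;> rfl
  have e2 : (fun j : Fin 2 => v ((Equiv.swap 0 1 : Equiv.Perm (Fin 2))⁻¹ j)) = ![v 1, v 0] := by
    funext j; fin_cases j <;> rfl
  unfold shuffle
  rw [show Finset.Ico 1 2 = {1} from rfl, Finset.sum_singleton, huniv,
    Finset.sum_pair (by decide), if_pos hs1, if_pos hs2, e1, e2]
  simp
  ring

/-- The identity is a shuffle for both `r = 1` and `r = 2`, whence the coefficient `2`; the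
transposition of the outer entries is one for neither. -/
lemma shuffle_three_apply (φ : Cochain k P 3) (v : Fin 3 → M) :
    shuffle φ v = 2 * ev φ ![v 0, v 1, v 2] - ev φ ![v 1, v 0, v 2] - ev φ ![v 0, v 2, v 1]
      + ev φ ![v 1, v 2, v 0] + ev φ ![v 2, v 0, v 1] := by
  classical
  have huniv : (Finset.univ : Finset (Equiv.Perm (Fin 3))) =
    {1, Equiv.swap 0 1, Equiv.swap 1 2, Equiv.swap 0 2, finRotate 3, (finRotate 3)⁻¹} := by
    decide
  have a1 : IsShuffle 1 (1 : Equiv.Perm (Fin 3)) := by unfold IsShuffle; decide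
  have a2 : IsShuffle 1 (Equiv.swap 0 1 : Equiv.Perm (Fin 3)) := by unfold IsShuffle; decide
  have a3 : ¬ IsShuffle 1 (Equiv.swap 1 2 : Equiv.Perm (Fin 3)) := by unfold IsShuffle; decide
  have a4 : ¬ IsShuffle 1 (Equiv.swap 0 2 : Equiv.Perm (Fin 3)) := by unfold IsShuffle; decide
  have a5 : ¬ IsShuffle 1 (finRotate 3) := by unfold IsShuffle; decide
  have a6 : IsShuffle 1 (finRotate 3)⁻¹ := by unfold IsShuffle; decide
  have b1 : IsShuffle 2 (1 : Equiv.Perm (Fin 3)) := by unfold IsShuffle; decide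
  have b2 : ¬ IsShuffle 2 (Equiv.swap 0 1 : Equiv.Perm (Fin 3)) := by unfold IsShuffle; decide
  have b3 : IsShuffle 2 (Equiv.swap 1 2 : Equiv.Perm (Fin 3)) := by unfold IsShuffle; decide
  have b4 : ¬ IsShuffle 2 (Equiv.swap 0 2 : Equiv.Perm (Fin 3)) := by unfold IsShuffle; decide
  have b5 : IsShuffle 2 (finRotate 3) := by unfold IsShuffle; decide
  have b6 : ¬ IsShuffle 2 (finRotate 3)⁻¹ := by unfold IsShuffle; decide
  have e1 : (fun j : Fin 3 => v ((1 : Equiv.Perm (Fin 3))⁻¹ j)) = ![v 0, v 1, v 2] := by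
    funext j; fin_cases j <;> rfl
  have e2 : (fun j : Fin 3 => v ((Equiv.swap 0 1 : Equiv.Perm (Fin 3))⁻¹ j)) =
      ![v 1, v 0, v 2] := by
    funext j; fin_cases j <;> rfl
  have e3 : (fun j : Fin 3 => v ((Equiv.swap 1 2 : Equiv.Perm (Fin 3))⁻¹ j)) =
      ![v 0, v 2, v 1] := by
    funext j; fin_cases j <;> rfl
  have e5 : (fun j : Fin 3 => v ((finRotate 3)⁻¹ j)) = ![v 2, v 0, v 1] := by
    funext j; fin_cases j <;> rfl
  have e6 : (fun j : Fin 3 => v ((finRotate 3)⁻¹⁻¹ j)) = ![v 1, v 2, v 0] := by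
    funext j; fin_cases j <;> rfl
  have s2 : Equiv.Perm.sign (Equiv.swap 0 1 : Equiv.Perm (Fin 3)) = -1 := by decide
  have s3 : Equiv.Perm.sign (Equiv.swap 1 2 : Equiv.Perm (Fin 3)) = -1 := by decide
  have s5 : Equiv.Perm.sign (finRotate 3) = 1 := by decide
  have s6 : Equiv.Perm.sign (finRotate 3)⁻¹ = 1 := by decide
  unfold shuffle
  rw [show Finset.Ico 1 3 = {1, 2} from rfl, Finset.sum_pair (by decide), huniv]
  repeat rw [Finset.sum_insert (by decide)]
  repeat rw [Finset.sum_singleton]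
  rw [if_pos a1, if_pos a2, if_neg a3, if_neg a4, if_neg a5, if_pos a6, if_pos b1, if_neg b2,
    if_pos b3, if_neg b4, if_pos b5, if_neg b6, e1, e2, e3, e5, e6, s2, s3, s5, s6]
  simp
  ring

lemma ev_coe (φ : Cochain k P 2) (v : tuples P 2) : φ v = ev φ ![v.1 0, v.1 1] := by
  have h : v.1 = ![v.1 0, v.1 1] := by funext j; fin_cases j <;> rfl
  rw [← h, ev_of_mem φ v.2]

lemma ev_coe_three (φ : Cochain k P 3) (v : tuples P 3) :
    φ v = ev φ ![v.1 0, v.1 1, v.1 2] := by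
  have h : v.1 = ![v.1 0, v.1 1, v.1 2] := by funext j; fin_cases j <;> rfl
  rw [← h, ev_of_mem φ v.2]

lemma swap_mem_tuples {a b : M} (h : ![a, b] ∈ tuples P 2) : ![b, a] ∈ tuples P 2 := by
  obtain ⟨h1, h2⟩ := h
  refine ⟨fun j => ?_, ?_⟩
  · fin_cases j
    · exact h1 1
    · exact h1 0
  · rw [Fin.sum_univ_two] at h2 ⊢
    rw [add_comm]
    exact h2

/-- Membership in `S_2(P)` is symmetric and `ev` is zero outside it, so the symmetry extends to all
arguments. This is needed for shifted ones such as `-S + a + b`. -/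
lemma ev_swap {φ : Cochain k P 2} {ε : k}
    (h : ∀ v : tuples P 2, ev φ ![v.1 0, v.1 1] = ε * ev φ ![v.1 1, v.1 0]) (a b : M) :
    ev φ ![a, b] = ε * ev φ ![b, a] := by
  by_cases hab : ![a, b] ∈ tuples P 2
  · exact h ⟨_, hab⟩
  · have hba : ![b, a] ∉ tuples P 2 := fun h => hab (swap_mem_tuples h)
    rw [ev, dif_neg hab, ev, dif_neg hba, mul_zero]

/-- The eigenvalue is `2 ^ 2 - 2 = 2`, and `φ(a, b) - φ(b, a) = 2 φ(a, b)` is antisymmetry. For `i =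
1` the eigenvalue is `0`, which gives symmetry. -/
lemma ev_antisymm [CharZero k] {Q : Set M} {φ : Cochain k P 2} (hφ : φ ∈ hodge k 2 2 P Q)
    (a b : M) : ev φ ![a, b] = -ev φ ![b, a] := by
  rw [← neg_one_mul]
  refine ev_swap (fun v => ?_) a b
  have h := hφ.2.1 v
  rw [shuffle_two_apply, ev_coe φ v] at h
  linear_combination -h

lemma mem_hodge_two_two {Q : Set M} {φ : Cochain k P 2}
    (h : ∀ v : tuples P 2, ev φ ![v.1 0, v.1 1] = -ev φ ![v.1 1, v.1 0])
    (h0 : ∀ v : tuples P 2, (v : Fin 2 → M) ∈ tuples Q 2 → φ v = 0) :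
    φ ∈ hodge k 2 2 P Q := by
  refine ⟨fun h => absurd h (by omega), fun v => ?_, h0⟩
  rw [shuffle_two_apply, ev_coe φ v]
  linear_combination -h v

lemma mem_hodge_one_two {Q : Set M} {φ : Cochain k P 2}
    (h : ∀ v : tuples P 2, ev φ ![v.1 0, v.1 1] = ev φ ![v.1 1, v.1 0])
    (h0 : ∀ v : tuples P 2, (v : Fin 2 → M) ∈ tuples Q 2 → φ v = 0) :
    φ ∈ hodge k 1 2 P Q := by
  refine ⟨fun h => absurd h (by omega), fun v => ?_, h0⟩
  rw [shuffle_two_apply]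
  linear_combination h v

/-- Cochains of degree three that are invariant under reversal lie in the piece `i = 2`. -/
lemma mem_hodge_two_three {Q : Set M} {φ : Cochain k P 3}
    (h : ∀ a b c, a ∈ P → b ∈ P → c ∈ P → ev φ ![a, b, c] = ev φ ![c, b, a])
    (h0 : ∀ v : tuples P 3, (v : Fin 3 → M) ∈ tuples Q 3 → φ v = 0) :
    φ ∈ hodge k 2 3 P Q := by
  refine ⟨fun h => absurd h (by omega), fun v => ?_, h0⟩
  have hv := v.2.1
  rw [shuffle_three_apply, ev_coe_three φ v]
  -- The eigenvalue `2` is the coefficient of the identity shuffle; the other four terms cancel in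
  -- pairs under reversal.
  linear_combination h _ _ _ (hv 1) (hv 2) (hv 0) + h _ _ _ (hv 2) (hv 0) (hv 1)

end LowDegree

/-! ### The Gerstenhaber product and the cochain `B` -/

section Product

variable {N : Type*} [AddCommGroup N] {k : Type*} [Field k] {σ : RationalCone N}

/-- One half of the Gerstenhaber product, for functions on an abelian group. -/
def insertion {M : Type*} [AddCommGroup M] (S : M) (f g : M → M → k) (a b c : M) : k :=
  f (-S + a + b) c * g a b - f a (-S + b + c) * g b c

/-- Three instances of the cocycle identity of `f`, weighted by values of `g`, and two of that of
`g`, weighted by values of `f`, leave only two products of values. They change sign when `f` and `g`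
are exchanged, which makes the full product closed. -/
lemma insertion_coboundary {M : Type*} [AddCommGroup M] {P : Set M} {S : M} {f g : M → M → k}
    (hf : ∀ a b c, a ∈ P → b ∈ P → c ∈ P → f b c - f (a + b) c + f a (b + c) - f a b = 0)
    (hg : ∀ a b c, a ∈ P → b ∈ P → c ∈ P → g b c - g (a + b) c + g a (b + c) - g a b = 0)
    (hS : ∀ a b, a ∈ P → b ∈ P → g a b ≠ 0 → -S + a + b ∈ P)
    {a b c d : M} (ha : a ∈ P) (hb : b ∈ P) (hc : c ∈ P) (hd : d ∈ P) :
    insertion S f g b c d - insertion S f g (a + b) c d + insertion S f g a (b + c) d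
      - insertion S f g a b (c + d) + insertion S f g a b c =
        f c d * g a b - f a b * g c d := by
  -- The cocycle identity of `f` is available only when the shifted argument lies in `P`; otherwise
  -- the factor `g x y` vanishes.
  have hmul : ∀ {x y u v w : M}, x ∈ P → y ∈ P →
      (-S + x + y ∈ P → f v w - f (u + v) w + f u (v + w) - f u v = 0) →
      g x y * (f v w - f (u + v) w + f u (v + w) - f u v) = 0 := by
    intro x y u v w hx hy h
    by_cases h0 : g x y = 0
    · rw [h0, zero_mul]
    · rw [h (hS x y hx hy h0), mul_zero]
  have p1 := hmul (u := -S + a + b) (v := c) (w := d) ha hb fun h => hf _ _ _ h hc hd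
  have p2 := hmul (u := a) (v := -S + b + c) (w := d) hb hc fun h => hf _ _ _ ha h hd
  have p3 := hmul (u := a) (v := b) (w := -S + c + d) hc hd fun h => hf _ _ _ ha hb h
  rw [show a + (-S + b + c) = -S + a + b + c by abel] at p2
  rw [show b + (-S + c + d) = -S + b + c + d by abel] at p3
  have q1 := hg a b c ha hb hc
  have q2 := hg b c d hb hc hd
  unfold insertion
  simp only [← add_assoc] at p1 p2 p3 q1 q2 ⊢
  linear_combination f (-S + a + b + c) d * q1 + f a (-S + b + c + d) * q2 - p1 + p2 - p3

lemma mem_tuples_latticePoints {n : ℕ} {v : Fin n → Module.Dual ℤ N}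
    (h : ∀ j, v j ∈ σ.latticePoints) : v ∈ tuples σ.latticePoints n :=
  ⟨h, fun x hx => by
    rw [pairing_sum]
    exact Finset.sum_nonneg fun j _ => h j x hx⟩

lemma one_mem {a : Module.Dual ℤ N} (ha : a ∈ σ.latticePoints) :
    ![a] ∈ tuples σ.latticePoints 1 :=
  mem_tuples_latticePoints fun j => by fin_cases j; exact ha

lemma two_mem {a b : Module.Dual ℤ N} (ha : a ∈ σ.latticePoints) (hb : b ∈ σ.latticePoints) :
    ![a, b] ∈ tuples σ.latticePoints 2 :=
  mem_tuples_latticePoints fun j => by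
    fin_cases j
    · exact ha
    · exact hb

lemma three_mem {a b c : Module.Dual ℤ N} (ha : a ∈ σ.latticePoints)
    (hb : b ∈ σ.latticePoints) (hc : c ∈ σ.latticePoints) :
    ![a, b, c] ∈ tuples σ.latticePoints 3 :=
  mem_tuples_latticePoints fun j => by
    fin_cases j
    · exact ha
    · exact hb
    · exact hc

lemma ev_diff_one (φ : Cochain k σ.latticePoints 1) {a b : Module.Dual ℤ N}
    (ha : a ∈ σ.latticePoints) (hb : b ∈ σ.latticePoints) :
    ev (diff 1 φ) ![a, b] = ev φ ![b] - ev φ ![a + b] + ev φ ![a] := by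
  rw [ev_of_mem _ (two_mem ha hb), diff_one_apply]
  rfl

lemma ev_diff_two (φ : Cochain k σ.latticePoints 2) {a b c : Module.Dual ℤ N}
    (ha : a ∈ σ.latticePoints) (hb : b ∈ σ.latticePoints) (hc : c ∈ σ.latticePoints) :
    ev (diff 2 φ) ![a, b, c] =
      ev φ ![b, c] - ev φ ![a + b, c] + ev φ ![a, b + c] - ev φ ![a, b] := by
  rw [ev_of_mem _ (three_mem ha hb hc), diff_two_apply]
  rfl

lemma diff_diff_one (φ : Cochain k σ.latticePoints 1) : diff 2 (diff 1 φ) = 0 := by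
  funext v
  have hv := v.2.1
  rw [diff_two_apply, ev_diff_one _ (hv 1) (hv 2),
    ev_diff_one _ (latticePoints_add (hv 0) (hv 1)) (hv 2),
    ev_diff_one _ (hv 0) (latticePoints_add (hv 1) (hv 2)), ev_diff_one _ (hv 0) (hv 1),
    add_assoc]
  simp only [Pi.zero_apply]
  ring

lemma diff_diff_two (φ : Cochain k σ.latticePoints 2) : diff 3 (diff 2 φ) = 0 := by
  funext v
  have hv := v.2.1
  rw [diff_three_apply, ev_diff_two _ (hv 1) (hv 2) (hv 3),
    ev_diff_two _ (latticePoints_add (hv 0) (hv 1)) (hv 2) (hv 3),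
    ev_diff_two _ (hv 0) (latticePoints_add (hv 1) (hv 2)) (hv 3),
    ev_diff_two _ (hv 0) (hv 1) (latticePoints_add (hv 2) (hv 3)),
    ev_diff_two _ (hv 0) (hv 1) (hv 2)]
  simp only [Pi.zero_apply, ← add_assoc]
  ring

lemma cocycle_identity {φ : Cochain k σ.latticePoints 2} (h : diff 2 φ = 0)
    (a b c : Module.Dual ℤ N) (ha : a ∈ σ.latticePoints) (hb : b ∈ σ.latticePoints)
    (hc : c ∈ σ.latticePoints) :
    ev φ ![b, c] - ev φ ![a + b, c] + ev φ ![a, b + c] - ev φ ![a, b] = 0 := by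
  rw [← ev_diff_two φ ha hb hc, h, ev_of_mem _ (three_mem ha hb hc)]
  rfl

/-- For antisymmetric `φ`, reversing the arguments exchanges the outer terms of `dφ` with each
other, and likewise the inner ones, so `dφ` is invariant under reversal. -/
lemma diff_two_mem_hodge [CharZero k] {Q : Set (Module.Dual ℤ N)}
    {φ : Cochain k σ.latticePoints 2} (hφ : φ ∈ hodge k 2 2 σ.latticePoints Q) :
    diff 2 φ ∈ hodge k 2 3 σ.latticePoints ∅ := by
  refine mem_hodge_two_three (fun a b c ha hb hc => ?_) fun v hv => absurd (hv.1 0) (by simp)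
  have h := ev_antisymm hφ
  rw [ev_diff_two φ ha hb hc, ev_diff_two φ hc hb ha, h b a, h (c + b) a, h c (b + a), h c b,
    add_comm c b, add_comm b a]
  ring

/-- The support of a relative cochain of degree `-S`. -/
lemma mem_of_ev_ne_zero {i : ℕ} {S : Module.Dual ℤ N} {φ : Cochain k σ.latticePoints 2}
    (hφ : φ ∈ hodge k i 2 σ.latticePoints (σ.latticePoints \ σ.shifted S))
    (a b : Module.Dual ℤ N) (ha : a ∈ σ.latticePoints) (hb : b ∈ σ.latticePoints)
    (h : ev φ ![a, b] ≠ 0) : -S + a + b ∈ σ.latticePoints := by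
  by_contra hcon
  -- Since `Λ(S)` absorbs addition of elements of `Λ`, having `a + b` outside it keeps `a` and `b`
  -- outside too, where `φ` vanishes by relativity.
  have hsum : a + b ∉ σ.shifted S := fun h' => hcon (by
    rw [show -S + a + b = a + b - S by abel]
    exact h')
  have ha' : a ∉ σ.shifted S := fun h' => hcon (by
    rw [show -S + a + b = a - S + b by abel]
    exact latticePoints_add h' hb)
  have hb' : b ∉ σ.shifted S := fun h' => hcon (by
    rw [show -S + a + b = b - S + a by abel]
    exact latticePoints_add h' ha)
  refine h ((ev_of_mem φ (two_mem ha hb)).trans (hφ.2.2 _ ⟨fun j => ?_, ?_⟩))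
  · fin_cases j
    · exact ⟨ha, ha'⟩
    · exact ⟨hb, hb'⟩
  · change ∑ j, ![a, b] j ∈ _
    rw [Fin.sum_univ_two]
    exact ⟨latticePoints_add ha hb, hsum⟩

lemma ev_bracket (R S : Module.Dual ℤ N) (f g : Cochain k σ.latticePoints 2)
    {a b c : Module.Dual ℤ N} (ha : a ∈ σ.latticePoints) (hb : b ∈ σ.latticePoints)
    (hc : c ∈ σ.latticePoints) :
    ev (bracket R S f g) ![a, b, c] =
      insertion S (fun x y => ev f ![x, y]) (fun x y => ev g ![x, y]) a b c +
        insertion R (fun x y => ev g ![x, y]) (fun x y => ev f ![x, y]) a b c := by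
  rw [ev_of_mem _ (three_mem ha hb hc)]
  exact add_sub_assoc _ _ _

lemma diff_bracket {i j : ℕ} {R S : Module.Dual ℤ N} {f g : Cochain k σ.latticePoints 2}
    (hf : f ∈ cocycles k i 2 σ.latticePoints (σ.latticePoints \ σ.shifted R))
    (hg : g ∈ cocycles k j 2 σ.latticePoints (σ.latticePoints \ σ.shifted S)) :
    diff 3 (bracket R S f g) = 0 := by
  funext v
  have hv := v.2.1
  have h1 := insertion_coboundary (cocycle_identity hf.2) (cocycle_identity hg.2)
    (mem_of_ev_ne_zero hg.1) (hv 0) (hv 1) (hv 2) (hv 3)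
  have h2 := insertion_coboundary (cocycle_identity hg.2) (cocycle_identity hf.2)
    (mem_of_ev_ne_zero hf.1) (hv 0) (hv 1) (hv 2) (hv 3)
  rw [diff_three_apply, ev_bracket R S f g (hv 1) (hv 2) (hv 3),
    ev_bracket R S f g (latticePoints_add (hv 0) (hv 1)) (hv 2) (hv 3),
    ev_bracket R S f g (hv 0) (latticePoints_add (hv 1) (hv 2)) (hv 3),
    ev_bracket R S f g (hv 0) (hv 1) (latticePoints_add (hv 2) (hv 3)),
    ev_bracket R S f g (hv 0) (hv 1) (hv 2)]
  simp only [Pi.zero_apply]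
  linear_combination h1 + h2

/-- A nonzero term uses the support condition twice: the inner factor puts the shifted argument in
`Λ`, then the outer one puts `a + b + c - (R + S)` in `Λ`. -/
lemma insertion_eq_zero {i j : ℕ} {R S : Module.Dual ℤ N} {f g : Cochain k σ.latticePoints 2}
    (hf : f ∈ hodge k i 2 σ.latticePoints (σ.latticePoints \ σ.shifted R))
    (hg : g ∈ hodge k j 2 σ.latticePoints (σ.latticePoints \ σ.shifted S))
    {a b c : Module.Dual ℤ N} (ha : a ∈ σ.latticePoints) (hb : b ∈ σ.latticePoints)
    (hc : c ∈ σ.latticePoints) (h : a + b + c ∉ σ.shifted (R + S)) :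
    insertion S (fun x y => ev f ![x, y]) (fun x y => ev g ![x, y]) a b c = 0 := by
  have h1 : ev f ![-S + a + b, c] * ev g ![a, b] = 0 := by
    by_contra hne
    obtain ⟨hne1, hne2⟩ := mul_ne_zero_iff.1 hne
    have := mem_of_ev_ne_zero hf _ _ (mem_of_ev_ne_zero hg _ _ ha hb hne2) hc hne1
    refine h ?_
    change _ ∈ σ.latticePoints
    rwa [show a + b + c - (R + S) = -R + (-S + a + b) + c by abel]
  have h2 : ev f ![a, -S + b + c] * ev g ![b, c] = 0 := by
    by_contra hne
    obtain ⟨hne1, hne2⟩ := mul_ne_zero_iff.1 hne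
    have := mem_of_ev_ne_zero hf _ _ ha (mem_of_ev_ne_zero hg _ _ hb hc hne2) hne1
    refine h ?_
    change _ ∈ σ.latticePoints
    rwa [show a + b + c - (R + S) = -R + a + (-S + b + c) by abel]
  unfold insertion
  rw [h1, h2, sub_zero]

lemma bracket_eq_zero {i j : ℕ} {R S : Module.Dual ℤ N} {f g : Cochain k σ.latticePoints 2}
    (hf : f ∈ hodge k i 2 σ.latticePoints (σ.latticePoints \ σ.shifted R))
    (hg : g ∈ hodge k j 2 σ.latticePoints (σ.latticePoints \ σ.shifted S))
    (v : tuples σ.latticePoints 3)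
    (hv : v.1 ∈ tuples (σ.latticePoints \ σ.shifted (R + S)) 3) :
    bracket R S f g v = 0 := by
  have hsum := hv.2.2
  rw [Fin.sum_univ_three] at hsum
  have hΛ := v.2.1
  rw [ev_coe_three (bracket R S f g) v, ev_bracket R S f g (hΛ 0) (hΛ 1) (hΛ 2),
    insertion_eq_zero hf hg (hΛ 0) (hΛ 1) (hΛ 2) hsum,
    insertion_eq_zero hg hf (hΛ 0) (hΛ 1) (hΛ 2) (by rwa [add_comm S R]), add_zero]

/-- The product of a symmetric and an antisymmetric cocycle. -/
lemma bracket_mem_cocycles [CharZero k] {R S : Module.Dual ℤ N}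
    {f g : Cochain k σ.latticePoints 2}
    (hf : f ∈ cocycles k 1 2 σ.latticePoints (σ.latticePoints \ σ.shifted R))
    (hfs : ∀ a b, ev f ![a, b] = ev f ![b, a])
    (hg : g ∈ cocycles k 2 2 σ.latticePoints (σ.latticePoints \ σ.shifted S)) :
    bracket R S f g ∈ cocycles k 2 3 σ.latticePoints
      (σ.latticePoints \ σ.shifted (R + S)) := by
  refine ⟨mem_hodge_two_three (fun a b c ha hb hc => ?_) (bracket_eq_zero hf.1 hg.1),
    diff_bracket hf hg⟩
  rw [ev_bracket R S f g ha hb hc, ev_bracket R S f g hc hb ha]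
  -- Reversal exchanges the two terms of each half; the sign from the antisymmetric factor
  -- compensates the minus sign between them.
  unfold insertion
  have hga := ev_antisymm hg.1
  simp only
  rw [add_right_comm (-S) c b, add_right_comm (-S) b a, add_right_comm (-R) c b,
    add_right_comm (-R) b a, hfs (-S + b + c) a, hga c b, hfs c (-S + a + b), hga b a,
    hga (-R + b + c) a, hfs c b, hga c (-R + a + b), hfs b a]
  ring

variable {R S : Module.Dual ℤ N}

lemma ev_diff_extendZero_comm (μ : Cochain k (σ.latticePoints \ σ.shifted S) 1)
    (a b : Module.Dual ℤ N) :
    ev (diff 1 (extendZero μ)) ![a, b] = ev (diff 1 (extendZero μ)) ![b, a] := by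
  rw [← one_mul (ev _ ![b, a])]
  refine ev_swap (fun v => ?_) a b
  have hv := v.2.1
  rw [ev_diff_one _ (hv 0) (hv 1), ev_diff_one _ (hv 1) (hv 0), add_comm (v.1 1) (v.1 0)]
  ring

/-- Symmetry comes from commutativity of addition. On tuples in `Λ ∖ Λ(S)` the extension by zero
plays no role, and additivity of `μ` gives zero. -/
lemma diff_extendZero_mem_cocycles {i : ℕ} {μ : Cochain k (σ.latticePoints \ σ.shifted S) 1}
    (hμ : μ ∈ cocycles k i 1 (σ.latticePoints \ σ.shifted S) ∅) :
    diff 1 (extendZero μ) ∈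
      cocycles k 1 2 σ.latticePoints (σ.latticePoints \ σ.shifted S) := by
  refine ⟨mem_hodge_one_two (fun v => ev_diff_extendZero_comm μ _ _) fun v hv => ?_,
    diff_diff_one _⟩
  have hΛ := v.2.1
  have h := congrFun (show diff 1 μ = 0 from hμ.2) ⟨v.1, hv⟩
  rw [diff_one_apply] at h
  rw [diff_one_apply, extendZero, ev_res μ (one_mem (hΛ 1)),
    ev_res μ (one_mem (latticePoints_add (hΛ 0) (hΛ 1))), ev_res μ (one_mem (hΛ 0))]
  exact h

/-- Swapping the arguments exchanges the two summands of `B₁` and fixes the factor `μ⁰` in `B₂`, so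
antisymmetry of `ξ` passes to `B`. -/
lemma cochainB_mem_hodge [CharZero k] {Q : Set (Module.Dual ℤ N)}
    (μ : Cochain k (σ.latticePoints \ σ.shifted S) 1) {ξ : Cochain k σ.latticePoints 2}
    (hξ : ξ ∈ hodge k 2 2 σ.latticePoints Q) :
    cochainB R S μ ξ ∈ hodge k 2 2 σ.latticePoints ∅ := by
  refine mem_hodge_two_two (fun v => ?_) fun v hv => absurd (hv.1 0) (by simp)
  have hv := v.2.1
  rw [ev_of_mem _ (two_mem (hv 0) (hv 1)), ev_of_mem _ (two_mem (hv 1) (hv 0))]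
  have h : ∀ a b (ha : a ∈ σ.latticePoints) (hb : b ∈ σ.latticePoints),
      cochainB R S μ ξ ⟨![a, b], two_mem ha hb⟩ =
        (ev ξ ![-S + a + b, b] * ev (extendZero μ) ![a]
          + ev ξ ![a, -S + a + b] * ev (extendZero μ) ![b])
        - ev ξ ![a, b] * ev (extendZero μ) ![a + b - R] := fun _ _ _ _ => rfl
  rw [h _ _ (hv 0) (hv 1), h _ _ (hv 1) (hv 0), add_comm (v.1 1) (v.1 0),
    add_right_comm (-S) (v.1 1) (v.1 0), ev_antisymm hξ (v.1 1) (v.1 0),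
    ev_antisymm hξ (v.1 1) (-S + v.1 0 + v.1 1), ev_antisymm hξ _ (v.1 0)]
  ring

end Product

end

end ToricHochschild

/-! ### The main theorem -/

theorem corollary5p2 {k : Type*} [Field k] [CharZero k]
    {N : Type*} [AddCommGroup N] [Module.Free ℤ N] [Module.Finite ℤ N]
    (σ : ToricHochschild.RationalCone N) (o : σ.Orientations) (R S : Module.Dual ℤ N)
    (μ : ToricHochschild.Cochain k (σ.latticePoints \ σ.shifted S) 1)
    (hμ : μ ∈ ToricHochschild.cocycles k 1 1 (σ.latticePoints \ σ.shifted S) ∅)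
    (ξ : ToricHochschild.Cochain k σ.latticePoints 2)
    (hξ : ξ ∈ ToricHochschild.cocycles k 2 2 σ.latticePoints
      (σ.latticePoints \ σ.shifted R)) :
    let dμ := ToricHochschild.diff 1 (ToricHochschild.extendZero μ)
    let g := ToricHochschild.bracket S R dμ ξ
    let B := ToricHochschild.cochainB R S μ ξ
    let z : ToricHochschild.BigradedSpace k σ (R + S) :=
      ToricHochschild.inBidegree 1 2
          (ToricHochschild.horizontal o 0 2 (ToricHochschild.onVertex (R + S) 2 B)) +
        ToricHochschild.inBidegree 0 3
          (ToricHochschild.onVertex (R + S) 3 (ToricHochschild.diff 2 B - g))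
    dμ ∈ ToricHochschild.cocycles k 1 2 σ.latticePoints (σ.latticePoints \ σ.shifted S) ∧
    B ∈ ToricHochschild.hodge k 2 2 σ.latticePoints ∅ ∧
    Function.Injective (ToricHochschild.toTotal k (R + S) o 2 2) ∧
    ∃ (hg : g ∈ ToricHochschild.cocycles k 2 3 σ.latticePoints
        (σ.latticePoints \ σ.shifted (R + S)))
      (hz : z ∈ ToricHochschild.totalCocycles k (R + S) o 2 3),
      ToricHochschild.toTotal k (R + S) o 2 2 (Submodule.Quotient.mk ⟨g, hg⟩) =
        - Submodule.Quotient.mk ⟨z, hz⟩ := by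
  intro dμ g B z
  have hdμ : dμ ∈ ToricHochschild.cocycles k 1 2 σ.latticePoints
      (σ.latticePoints \ σ.shifted S) := ToricHochschild.diff_extendZero_mem_cocycles hμ
  have hB : B ∈ ToricHochschild.hodge k 2 2 σ.latticePoints ∅ :=
    ToricHochschild.cochainB_mem_hodge μ hξ.1
  have hg : g ∈ ToricHochschild.cocycles k 2 3 σ.latticePoints
      (σ.latticePoints \ σ.shifted (R + S)) := by
    rw [add_comm R S]
    exact ToricHochschild.bracket_mem_cocycles hdμ
      (ToricHochschild.ev_diff_extendZero_comm μ) hξ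
  have hgt := ToricHochschild.onVertex_mem_totalCocycles o hg
  -- This is the relation `D B = z + g`, from which both the cocycle property of `z` and the
  -- comparison of classes follow.
  have hsum : ToricHochschild.totalDiff o
      (ToricHochschild.inBidegree 0 2 (ToricHochschild.onVertex (R + S) 2 B)) =
        z + ToricHochschild.inBidegree 0 3 (ToricHochschild.onVertex (R + S) 3 g) := by
    rw [ToricHochschild.totalDiff_inBidegree_onVertex, add_assoc, ← map_add, ← map_add,
      sub_add_cancel]
  have hBt : ToricHochschild.totalDiff o
      (ToricHochschild.inBidegree 0 2 (ToricHochschild.onVertex (R + S) 2 B)) ∈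
        ToricHochschild.totalCocycles k (R + S) o 2 3 := by
    refine ⟨?_, ToricHochschild.totalDiff_totalDiff_onVertex o B
      (ToricHochschild.diff_diff_two B)⟩
    rw [ToricHochschild.totalDiff_inBidegree_onVertex]
    refine add_mem (ToricHochschild.inBidegree_mem_total (p := 1) (q := 2)
      (ToricHochschild.horizontal_mem_hodge o hB)) ?_
    exact ToricHochschild.onVertex_mem_total (ToricHochschild.diff_two_mem_hodge hB)
  have hz : z ∈ ToricHochschild.totalCocycles k (R + S) o 2 3 := by
    rw [eq_sub_of_add_eq hsum.symm]
    exact sub_mem hBt hgt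
  refine ⟨hdμ, hB, ToricHochschild.toTotal_injective o 2, hg, hz, ?_⟩
  rw [eq_neg_iff_add_eq_zero]
  change (Submodule.Quotient.mk (ToricHochschild.cocyclesToTotal o 2 3 ⟨g, hg⟩) + _ :
    ToricHochschild.TotalCohomology k (R + S) o 2 2) = 0
  rw [← Submodule.Quotient.mk_add, Submodule.Quotient.mk_eq_zero]
  -- The primitive of `g + z` is `B` at the vertex.
  exact ⟨_, ToricHochschild.onVertex_mem_total hB, hsum.trans (add_comm _ _)⟩
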